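/- **Doubly composite Chernoff–Stein lemma.** Let $\mathcal X$ be a finite alphabet, $\mathcal P(\mathcal Z)$ the set of probability distributions on a finite set $\mathcal Z$, and let $\mathcal R=(\mathcal R_n)_{n\ge 1}$ (null hypothesis) and $\mathcal S=(\mathcal S_n)_{n\ge1}$ (alternative hypothesis) be sequences of sets $\mathcal R_n,\mathcal S_n\subseteq\mathcal P(\mathcal X^n)$. Let $\beta_\varepsilon(\mathcal R_n\|\mathcal S_n)$ be the infimum of $\sup_{Q\in\mathcal S_n}\sum_{x}A(x)Q(x)$ over all tests $A:\mathcal X^n\to[0,1]$ with $\sup_{P\in\mathcal R_n}\sum_x(1-A(x))P(x)\le\varepsilon$ (suprema over the empty set being $0$), and let $$\mathrm{Stein}(\mathcal R\|\mathcal S)=\lim_{\varepsilon\to0^+}\liminf_{n\to\infty}-\tfrac1n\log\beta_\varepsilon(\mathcal R_n\|\mathcal S_n)\in[0,\infty].$$ Let $D(P\|Q)=\sum_xP(x)\log\frac{P(x)}{Q(x)}$ be the relative entropy ($+\infty$ unless $\mathrm{supp}\,P\subseteq\mathrm{supp}\,Q$; $\log$ is the natural logarithm, another base rescaling all exponents alike),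 let $D(\mathcal A\|\mathcal B)=\inf_{P\in \mathcal A,\,Q\in \mathcal B}D(P\|Q)$ for sets $\mathcal A,\mathcal B$ of distributions (the infimum over the empty set being $+\infty$), and let $\mathrm{co}$ denote the convex hull. Consider the following properties of a sequence $\mathcal F=(\mathcal F_n)_{n\ge1}$ of sets $\mathcal F_n\subseteq\mathcal P(\mathcal X^n)$. - **(I)** There is $R\in\mathcal P(\mathcal X)$ such that for all $n\ge1$ and $Q\in\mathcal F_n$: $\mathrm{supp}\,Q\subseteq(\mathrm{supp}\,R)^n$, and $\mathcal D_{\delta,R}^{\otimes n}(Q)\in\mathcal F_n$ for all $\delta\in[0,1]$, where $\mathcal D_{\delta,R}$ is the channel $P\mapsto(1-\delta)P+\delta R$. - **(II)** $P^{\otimes n}\in\mathcal F_n$ for all $P\in\mathcal F_1$ and $n\ge1$. - **(III)** Each $\mathcal F_n$ is closed under permutations of the $n$ symbols. - **(III+)** Each $\mathcal F_n$ contains only distributions invariant under permutations of the $n$ symbols. - **(IV, type stability)** If $P\in\mathcal P(\mathcal X)$ and there is $K>0$ such that for every $\delta>0$ the inequality $\sup_{Q\in\mathcal F_n}\Pr_{X^n\sim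 Q}\{\frac12\|P_{X^n}-P\|_1\le\delta\}\ge n^{-K}$ holds for infinitely many $n$, where $P_{X^n}$ is the type (empirical distribution) of $X^n$, then $P\in\mathcal F_1$. - **(V, filtering)** There are a finite set $\mathcal Y$ and a channel $W:\mathcal X\to\mathcal Y$, with stochastic matrix of rank $|\mathcal X|$, such that for all $n\ge2$, $Q\in\mathcal F_n$ and $y\in\mathcal Y$: if $X_1\dots X_n\sim Q$ and $Y_n$ is the output of $W$ on input $X_n$, then the conditional distribution of $X_1\dots X_{n-1}$ given $Y_n=y$ belongs to $\mathcal F_{n-1}$ whenever $\Pr\{Y_n=y\}>0$. Assume that - (a) $\mathcal R$ satisfies (II) and (IV), and $\mathcal R_1$ is closed; - (b) $\mathcal S$ satisfies (I); - (c) $\mathcal R$ satisfies (III+), or $\mathcal S$ satisfies (III). Then the limit defining the Stein exponent exists in $[0,\infty]$ and $$\mathrm{Stein}(\mathcal R\|\mathcal S)=\inf_{P\in\mathcal R_1}D^\infty(P\|\mathrm{co}(\mathcal S))=\inf_{P\in\mathcal R_1}\liminf_{n\to\infty}\frac1n\,D\big(P^{\otimes n}\,\big\|\,\mathrm{co}(\mathcal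 S_n)\big),$$ where $D^\infty(P\|\mathrm{co}(\mathcal S))$ is the regularised relative entropy $\liminf_n\frac1nD(\{P^{\otimes n}\}\|\mathrm{co}(\mathcal S_n))$. The same conclusion holds if (b) is assumed and (a), (c) are replaced by - (a′) $\mathcal R$ satisfies (I), (II) and (V), all sets $\mathcal R_n$ are convex, and $\mathcal R_1$ is closed; - (c′) $\mathcal R$ satisfies (III+), or both $\mathcal R$ and $\mathcal S$ satisfy (III). -/

import Mathlib

open Filter Topology

noncomputable section

namespace DoublyComposite

/-- The set `P(X)` of probability distributions on a finite set `X`, as vectors of reals. -/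
abbrev ProbDist (X : Type*) [Fintype X] : Set (X → ℝ) := stdSimplex ℝ X

/-- A sequence `(F n)` of sets of real functions on the strings of length `n` over `X`. Only the
terms with `1 ≤ n` are ever used. -/
abbrev Family (X : Type*) : Type _ := (n : ℕ) → Set ((Fin n → X) → ℝ)

/-- Every `F n` (`1 ≤ n`) consists of probability distributions on `X ^ n`. -/
def IsHypothesis {X : Type*} [Fintype X] (F : Family X) : Prop :=
  ∀ n : ℕ, 1 ≤ n → F n ⊆ ProbDist (Fin n → X)

/-- The i.i.d. extension `P^{⊗ n}`. -/
def tensorPow {X : Type*} (P : X → ℝ) (n : ℕ) : (Fin n → X) → ℝ :=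
  fun x => ∏ i, P (x i)

/-- `F 1`, seen as a set of distributions on `X` (strings of length one are identified with
their only symbol). -/
def Family.base {X : Type*} (F : Family X) : Set (X → ℝ) :=
  {P | (fun x : Fin 1 → X => P (x 0)) ∈ F 1}

/-- The composite i.i.d. family with base set `A`. -/
def iidFamily {X : Type*} (A : Set (X → ℝ)) : Family X :=
  fun n => (fun P => tensorPow P n) '' A

/-- The sequence of the convex hulls of the sets `F n`. -/
def Family.co {X : Type*} (F : Family X) : Family X :=
  fun n => convexHull ℝ (F n)

/-! ### Hypothesis testing -/

/-- Worst-case probability of a type I error of the test `A` (`A z` is the probability of guessing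
the null hypothesis on the outcome `z`) for the set `R` of null distributions. -/
def typeIError {Z : Type*} [Fintype Z] (R : Set (Z → ℝ)) (A : Z → ℝ) : ENNReal :=
  ⨆ P ∈ R, ENNReal.ofReal (∑ z, (1 - A z) * P z)

/-- Worst-case probability of a type II error of the test `A`, for the set `S` of alternatives. -/
def typeIIError {Z : Type*} [Fintype Z] (S : Set (Z → ℝ)) (A : Z → ℝ) : ENNReal :=
  ⨆ Q ∈ S, ENNReal.ofReal (∑ z, A z * Q z)

/-- Minimal type II error probability `β_ε(R ‖ S)` given the threshold `ε` on the type I error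
probability; the infimum is over all tests `A : Z → [0,1]`. -/
def minTypeII {Z : Type*} [Fintype Z] (ε : ℝ) (R S : Set (Z → ℝ)) : ENNReal :=
  ⨅ A ∈ {A : Z → ℝ | (∀ z, A z ∈ Set.Icc (0 : ℝ) 1) ∧ typeIError R A ≤ ENNReal.ofReal ε},
    typeIIError S A

/-- `L` is the Stein exponent
`lim_{ε → 0⁺} liminf_{n → ∞} (-(1/n) log β_ε(R_n ‖ S_n))` (in `[-∞, ∞]`, with `-log 0 = ∞`). -/
def HasSteinExponent {X : Type*} [Fintype X] (R S : Family X) (L : EReal) : Prop :=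
  Tendsto
    (fun ε : ℝ =>
      liminf (fun n : ℕ => ((1 / (n : ℝ) : ℝ) : EReal) * -(minTypeII ε (R n) (S n)).log) atTop)
    (𝓝[>] 0) (𝓝 L)

/-! ### Relative entropies -/

open Classical in
/-- Relative entropy `D(P ‖ Q) = ∑ P log (P / Q)`, equal to `∞` unless `supp P ⊆ supp Q`. -/
def relEntropy {Z : Type*} [Fintype Z] (P Q : Z → ℝ) : EReal :=
  if ∀ z, Q z = 0 → P z = 0 then ((∑ z, P z * Real.log (P z / Q z) : ℝ) : EReal) else ⊤

/-- `D(A ‖ B) = inf_{P ∈ A, Q ∈ B} D(P ‖ Q)`. -/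
def relEntropySets {Z : Type*} [Fintype Z] (A B : Set (Z → ℝ)) : EReal :=
  ⨅ P ∈ A, ⨅ Q ∈ B, relEntropy P Q

/-- Regularised relative entropy `D^∞(R ‖ S) = liminf_n (1/n) D(R_n ‖ S_n)`. -/
def regRelEntropy {X : Type*} [Fintype X] (R S : Family X) : EReal :=
  liminf (fun n : ℕ => ((1 / (n : ℝ) : ℝ) : EReal) * relEntropySets (R n) (S n)) atTop

/-! ### Channels -/

/-- `W` is a channel (row-stochastic matrix): `W x y` is the probability `W(y|x)`. -/
def IsChannel {X Y : Type*} [Fintype Y] (W : Matrix X Y ℝ) : Prop :=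
  ∀ x, W x ∈ ProbDist Y

/-- Action of the `n`-fold tensor power of a channel on a distribution over strings. -/
def channelPow {X Y : Type*} [Fintype X] (W : Matrix X Y ℝ) (n : ℕ) (Q : (Fin n → X) → ℝ) :
    (Fin n → Y) → ℝ :=
  fun y => ∑ x, Q x * ∏ i, W (x i) (y i)

open Classical in
/-- The channel `D_{δ,R}`: with probability `δ` the symbol is replaced by one drawn from `R`, with
probability `1 - δ` it is kept. -/
def depol {X : Type*} (δ : ℝ) (R : X → ℝ) : Matrix X X ℝ :=
  fun x y => (1 - δ) * (if x = y then 1 else 0) + δ * R y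

/-- On single symbols, `D_{δ,R}(P) = (1 - δ) P + δ R`. -/
theorem sum_mul_depol {X : Type*} [Fintype X] (δ : ℝ) (R P : X → ℝ) (hP : P ∈ ProbDist X) (y : X) :
    ∑ x, P x * depol δ R x y = (1 - δ) * P y + δ * R y := by
  classical
  have h : ∀ x, P x * depol δ R x y
      = (1 - δ) * (if x = y then P x else 0) + (δ * R y) * P x := by
    intro x
    by_cases hxy : x = y <;> simp [depol, hxy] <;> ring
  simp only [h, Finset.sum_add_distrib, ← Finset.mul_sum, hP.2]
  simp

/-! ### Assumptions on a family -/

/-- Symbol-wise mixing with a fixed distribution `R` preserves the family, and every member is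
supported on strings over the support of `R`. -/
def ClosedUnderMixing {X : Type*} [Fintype X] (F : Family X) : Prop :=
  ∃ R ∈ ProbDist X, ∀ n : ℕ, 1 ≤ n → ∀ Q ∈ F n,
    (∀ x, 0 < Q x → ∀ i, 0 < R (x i)) ∧
    ∀ δ ∈ Set.Icc (0 : ℝ) 1, channelPow (depol δ R) n Q ∈ F n

/-- Tensor powers of the distributions in `F 1` belong to the family. -/
def ClosedUnderTensorPowers {X : Type*} (F : Family X) : Prop :=
  ∀ P ∈ F.base, ∀ n : ℕ, 1 ≤ n → tensorPow P n ∈ F n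

/-- Each `F n` is closed under permutations of the symbols. -/
def ClosedUnderPerms {X : Type*} (F : Family X) : Prop :=
  ∀ n : ℕ, 1 ≤ n → ∀ Q ∈ F n, ∀ π : Equiv.Perm (Fin n), (fun x => Q (x ∘ π)) ∈ F n

/-- Each `F n` contains only permutationally symmetric distributions. -/
def PermSymmetric {X : Type*} (F : Family X) : Prop :=
  ∀ n : ℕ, 1 ≤ n → ∀ Q ∈ F n, ∀ π : Equiv.Perm (Fin n), ∀ x, Q (x ∘ π) = Q x

open Classical in
/-- The type (empirical distribution) of a string. -/
def stringType {X : Type*} {n : ℕ} (x : Fin n → X) : X → ℝ :=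
  fun a => ((Finset.univ.filter fun i => x i = a).card : ℝ) / n

/-- Total variation distance `(1/2) ‖P - Q‖₁`. -/
def tvDist {X : Type*} [Fintype X] (P Q : X → ℝ) : ℝ := (1 / 2) * ∑ a, |P a - Q a|

open Classical in
/-- Probability under `Q` that the type of the string is `δ`-close to `P`. -/
def probTypeNear {X : Type*} [Fintype X] {n : ℕ} (Q : (Fin n → X) → ℝ) (P : X → ℝ) (δ : ℝ) : ℝ :=
  ∑ x with tvDist (stringType x) P ≤ δ, Q x

/-- Type stability. -/
def TypeStable {X : Type*} [Fintype X] (F : Family X) : Prop :=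
  ∀ P ∈ ProbDist X,
    (∃ K : ℝ, 0 < K ∧ ∀ δ : ℝ, 0 < δ → ∃ᶠ n : ℕ in atTop,
      ENNReal.ofReal (1 / (n : ℝ) ^ K) ≤ ⨆ Q ∈ F n, ENNReal.ofReal (probTypeNear Q P δ)) →
    P ∈ F.base

/-- Joint distribution of the first `n` symbols and of the event that the channel `W`, applied to
the last symbol, outputs `y`. -/
def jointLastOutput {X Y : Type*} [Fintype X] {n : ℕ} (W : Matrix X Y ℝ)
    (Q : (Fin (n + 1) → X) → ℝ) (y : Y) : (Fin n → X) → ℝ :=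
  fun x => ∑ a, Q (Fin.snoc (α := fun _ => X) x a) * W a y

/-- Conditional distribution of the first `n` symbols, given the output `y` of `W` on the last one
(meaningful if that output has positive probability). -/
def condLastOutput {X Y : Type*} [Fintype X] {n : ℕ} (W : Matrix X Y ℝ)
    (Q : (Fin (n + 1) → X) → ℝ) (y : Y) : (Fin n → X) → ℝ :=
  fun x => jointLastOutput W Q y x / ∑ x', jointLastOutput W Q y x'

/-- Filtering: some informationally complete channel `W` with finite output alphabet is such that
conditioning on any possible (that is, positive-probability) output of `W` on the last symbol
maps `F (n + 1)` to `F n`. -/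
def Filtering {X : Type*} [Fintype X] (F : Family X) : Prop :=
  ∃ (m : ℕ) (W : Matrix X (Fin m) ℝ), IsChannel W ∧ W.rank = Fintype.card X ∧
    ∀ n : ℕ, 1 ≤ n → ∀ Q ∈ F (n + 1), ∀ y : Fin m,
      0 < ∑ x, jointLastOutput W Q y x → condLastOutput W Q y ∈ F n

end DoublyComposite

end

/-!
The Stein exponent is sandwiched between two bounds, one for each direction.

*Converse.* A test with type I error at most `ε` and type II error `β` forces
`(1 - ε) log (1 / β) ≤ D(P^{⊗ n} ‖ Q) + log 2` for every `P ∈ R 1` and every mixture `Q` of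
alternatives (`mul_log_inv_le_sum`), by the variational formula for the relative entropy applied to
a multiple of the test.

*Achievability.* If `β_ε > exp (-c n)` for infinitely many `n`, the minimax theorem produces
mixtures `P'`, `Q` of null and alternative distributions with
`∑ min (P', ε exp (c n) Q) > ε` (`exists_sum_min_gt`). As there are only polynomially many types,
a single type class carries an inverse polynomial part of this overlap. By permutation symmetry, of
`P'` or of the (averaged) `Q`, the alternative `Q` then charges an inverse polynomial fraction `G` of
that class almost uniformly, with density at least `exp (-n (c + o(1)))` relative to the uniform
distribution (`exists_subset_typeClass`). Along a subsequence the types converge to some `P`, and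
type stability gives `P ∈ R 1` (`mem_base_of_tendsto`).

It remains to compare `P^{⊗ n}` with an alternative. Mixing each symbol of `Q` with the noise allowed
by the hypothesis on `S` gives a distribution whose value at `y` is at least
`Q z (1 - δ)^n (δ r)^{d(z, y)}` for the point `z` of `G` closest to `y`. Hence
`D(P^{⊗ n} ‖ ·)` exceeds `c n` by at most `n (H(T) - H(P)) + n log (1 / (1 - δ)) + o(n)` plus
`log (1 / (δ r))` times the mean Hamming distance from `G` under `P^{⊗ n}`, where `T` is the type
(`relEntropy_channelPow_depol_le`). That mean distance is sublinear as `T → P`: a Laplace transform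
bound for Hamming-Lipschitz functions (`sum_tensorPow_mul_exp_neg_le`) shows that the mean distance
from a set is at most `o(n) + n ‖P - T‖₁` when `T^{⊗ n}` gives it inverse polynomial
probability. No typicality or smoothing of `P^{⊗ n}` is needed, because only this mean enters.

*Filtering.* Under the second set of assumptions `R` is type stable, so that the first set applies.
If `P ∉ R 1`, a linear functional `g` separates `P` from the closed convex set `R 1`. For small
`t > 0`, `1 + t g` is the image under the filtering channel of a nonnegative function of the output,
so conditioning on one output after another bounds the mean of `∏ i, (1 + t g (x i))` by the `n`-th
power of its one-letter bound (`sum_mul_prod_le_pow`); types close to `P` therefore have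
exponentially small probability (`typeStable_of_filtering`).
-/

namespace DoublyComposite

/-! ### Product distributions -/

section ProductDistributions

variable {X : Type*} [Fintype X]

theorem sum_snoc {n : ℕ} (f : (Fin (n + 1) → X) → ℝ) :
    ∑ x, f x = ∑ x : Fin n → X, ∑ a, f (Fin.snoc (α := fun _ => X) x a) := by
  rw [← (Fin.snocEquiv (fun _ : Fin (n + 1) => X)).sum_comp f, Fintype.sum_prod_type_right]
  rfl

omit [Fintype X] in
theorem prod_snoc {n : ℕ} (φ : X → ℝ) (x : Fin n → X) (a : X) :
    ∏ i, φ (Fin.snoc (α := fun _ => X) x a i) = (∏ i, φ (x i)) * φ a := by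
  simp [Fin.prod_univ_castSucc]

theorem sum_tensorPow_succ {n : ℕ} (P : X → ℝ) (f : (Fin (n + 1) → X) → ℝ) :
    ∑ x, tensorPow P (n + 1) x * f x =
      ∑ x : Fin n → X, tensorPow P n x * ∑ a, P a * f (Fin.snoc (α := fun _ => X) x a) := by
  rw [sum_snoc]
  refine Finset.sum_congr rfl fun x _ => ?_
  rw [Finset.mul_sum]
  refine Finset.sum_congr rfl fun a _ => ?_
  simp only [tensorPow, prod_snoc]
  ring

theorem tensorPow_nonneg {P : X → ℝ} (hP : P ∈ ProbDist X) {n : ℕ} (x : Fin n → X) :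
    0 ≤ tensorPow P n x :=
  Finset.prod_nonneg fun _ _ => hP.1 _

theorem tensorPow_mem {P : X → ℝ} (hP : P ∈ ProbDist X) (n : ℕ) :
    tensorPow P n ∈ ProbDist (Fin n → X) := by
  refine ⟨tensorPow_nonneg hP, ?_⟩
  induction n with
  | zero => simp [tensorPow]
  | succ n ih =>
    have h := sum_tensorPow_succ (n := n) P (fun _ => 1)
    simpa [hP.2, ih] using h

theorem sum_tensorPow_mul_sum {P : X → ℝ} (hP : P ∈ ProbDist X) (φ : X → ℝ) (n : ℕ) :
    ∑ x, tensorPow P n x * ∑ i, φ (x i) = n * ∑ a, P a * φ a := by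
  induction n with
  | zero => simp
  | succ n ih =>
    rw [sum_tensorPow_succ]
    have h : ∀ x : Fin n → X,
        ∑ a, P a * ∑ i, φ (Fin.snoc (α := fun _ => X) x a i) =
          ∑ i, φ (x i) + ∑ a, P a * φ a := by
      intro x
      simp only [Fin.sum_univ_castSucc, Fin.snoc_castSucc, Fin.snoc_last, mul_add,
        Finset.sum_add_distrib, ← Finset.sum_mul, hP.2, one_mul]
    simp only [h, mul_add, Finset.sum_add_distrib, ih, ← Finset.sum_mul,
      (tensorPow_mem hP n).2]
    push_cast
    ring

/-- The exponential moment, under `T`, of a function of oscillation at most `1`, compared with its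
mean under a different distribution `P`. -/
theorem sum_mul_exp_neg_le {P T g : X → ℝ} (hP : P ∈ ProbDist X) (hT : T ∈ ProbDist X)
    (hg : ∀ a b, g a - g b ≤ 1) {t : ℝ} (ht0 : 0 ≤ t) (ht1 : t ≤ 1) :
    ∑ a, T a * Real.exp (-t * g a) ≤
      Real.exp (-t * ∑ a, P a * g a + t * ∑ a, |P a - T a| + t ^ 2) := by
  set m := ∑ a, T a * g a with hm
  have hgm : ∀ a, |g a - m| ≤ 1 := by
    intro a
    have h1 : g a - m = ∑ b, T b * (g a - g b) := by
      simp only [mul_sub, Finset.sum_sub_distrib, ← Finset.sum_mul, hT.2, one_mul, hm]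
    rw [h1, abs_le]
    constructor
    · have : ∑ b, T b * (-1 : ℝ) ≤ ∑ b, T b * (g a - g b) :=
        Finset.sum_le_sum fun b _ => mul_le_mul_of_nonneg_left (by linarith [hg b a]) (hT.1 b)
      rw [← Finset.sum_mul, hT.2] at this
      linarith
    · have : ∑ b, T b * (g a - g b) ≤ ∑ b, T b * (1 : ℝ) :=
        Finset.sum_le_sum fun b _ => mul_le_mul_of_nonneg_left (by linarith [hg a b]) (hT.1 b)
      rw [← Finset.sum_mul, hT.2] at this
      linarith
  have hexp : ∀ a, Real.exp (-t * g a) ≤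
      Real.exp (-t * m) * (1 - t * (g a - m) + t ^ 2) := by
    intro a
    have h1 : Real.exp (-t * g a) = Real.exp (-t * m) * Real.exp (-t * (g a - m)) := by
      rw [← Real.exp_add]; ring_nf
    rw [h1]
    refine mul_le_mul_of_nonneg_left ?_ (Real.exp_pos _).le
    have h2 : |-t * (g a - m)| ≤ 1 := by
      rw [abs_mul, abs_neg, abs_of_nonneg ht0]
      nlinarith [hgm a, abs_nonneg (g a - m)]
    have h3 := Real.abs_exp_sub_one_sub_id_le h2
    have h4 : (-t * (g a - m)) ^ 2 ≤ t ^ 2 := by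
      have := (sq_le_one_iff_abs_le_one (g a - m)).2 (hgm a)
      nlinarith [sq_nonneg t]
    linarith [(abs_le.1 h3).2]
  have hsum : ∑ a, T a * Real.exp (-t * g a) ≤ Real.exp (-t * m) * (1 + t ^ 2) := by
    calc ∑ a, T a * Real.exp (-t * g a)
        ≤ ∑ a, T a * (Real.exp (-t * m) * (1 - t * (g a - m) + t ^ 2)) :=
          Finset.sum_le_sum fun a _ => mul_le_mul_of_nonneg_left (hexp a) (hT.1 a)
      _ = ∑ a, (Real.exp (-t * m) * (1 + t ^ 2 + t * m) * T a
            - Real.exp (-t * m) * t * (T a * g a)) :=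
          Finset.sum_congr rfl fun a _ => by ring
      _ = Real.exp (-t * m) * (1 + t ^ 2) := by
          rw [Finset.sum_sub_distrib, ← Finset.mul_sum, ← Finset.mul_sum, hT.2, ← hm]; ring
  have hPm : ∑ a, P a * g a - m ≤ ∑ a, |P a - T a| := by
    have h1 : ∑ a, P a * g a - m = ∑ a, (P a - T a) * (g a - m) := by
      have : ∀ a, (P a - T a) * (g a - m) = P a * g a - T a * g a - (P a * m - T a * m) :=
        fun a => by ring
      simp only [this, Finset.sum_sub_distrib, ← Finset.sum_mul, hP.2, hT.2]
      simp [hm]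
    rw [h1]
    refine Finset.sum_le_sum fun a _ => (le_abs_self _).trans ?_
    rw [abs_mul]
    nlinarith [hgm a, abs_nonneg (P a - T a)]
  refine hsum.trans ?_
  have h5 : 1 + t ^ 2 ≤ Real.exp (t ^ 2) := by linarith [Real.add_one_le_exp (t ^ 2)]
  calc Real.exp (-t * m) * (1 + t ^ 2) ≤ Real.exp (-t * m) * Real.exp (t ^ 2) :=
        mul_le_mul_of_nonneg_left h5 (Real.exp_pos _).le
    _ = Real.exp (-t * m + t ^ 2) := (Real.exp_add _ _).symm
    _ ≤ _ := Real.exp_le_exp.2 (by nlinarith)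

/-- Lower-tail concentration of Hamming-Lipschitz functions: averaging out the last symbol preserves
the Lipschitz property, so the one-symbol bound tensorises. The moment is taken under `T^{⊗ n}` but
the mean under `P^{⊗ n}`, which accounts for the distance between `P` and `T`. -/
theorem sum_tensorPow_mul_exp_neg_le [DecidableEq X] {P T : X → ℝ} (hP : P ∈ ProbDist X)
    (hT : T ∈ ProbDist X)
    {t : ℝ} (ht0 : 0 ≤ t) (ht1 : t ≤ 1) {n : ℕ} (f : (Fin n → X) → ℝ)
    (hf : ∀ x y, f x - f y ≤ hammingDist x y) :
    ∑ x, tensorPow T n x * Real.exp (-t * f x) ≤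
      Real.exp (-t * ∑ x, tensorPow P n x * f x + n * (t * ∑ a, |P a - T a| + t ^ 2)) := by
  induction n with
  | zero => simp [tensorPow]
  | succ n ih =>
    set F : (Fin n → X) → ℝ := fun x => ∑ a, P a * f (Fin.snoc (α := fun _ => X) x a) with hF
    have hdist : ∀ (x y : Fin n → X) (a b : X),
        hammingDist (Fin.snoc (α := fun _ => X) x a) (Fin.snoc (α := fun _ => X) y b) =
          hammingDist x y + if a = b then 0 else 1 := by
      intro x y a b
      simp only [hammingDist, Finset.card_filter, Fin.sum_univ_castSucc, Fin.snoc_castSucc,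
        Fin.snoc_last]
      by_cases hab : a = b <;> simp [hab]
    have hFlip : ∀ x y, F x - F y ≤ hammingDist x y := by
      intro x y
      rw [hF]
      simp only [← Finset.sum_sub_distrib, ← mul_sub]
      calc _ ≤ ∑ a, P a * (hammingDist x y : ℝ) :=
            Finset.sum_le_sum fun a _ => mul_le_mul_of_nonneg_left
              ((hf _ _).trans (by rw [hdist]; simp)) (hP.1 a)
        _ = _ := by rw [← Finset.sum_mul, hP.2, one_mul]
    rw [sum_tensorPow_succ, sum_tensorPow_succ]
    set s := t * ∑ a, |P a - T a| + t ^ 2 with hs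
    calc ∑ x : Fin n → X, tensorPow T n x *
          ∑ a, T a * Real.exp (-t * f (Fin.snoc (α := fun _ => X) x a))
        ≤ ∑ x : Fin n → X, tensorPow T n x * (Real.exp (-t * F x) * Real.exp s) := by
          refine Finset.sum_le_sum fun x _ =>
            mul_le_mul_of_nonneg_left ?_ (tensorPow_nonneg hT x)
          rw [← Real.exp_add]
          have := sum_mul_exp_neg_le hP hT (g := fun a => f (Fin.snoc (α := fun _ => X) x a))
            (fun a b => (hf _ _).trans (by
              rw [hdist, hammingDist_self]; split_ifs <;> simp)) ht0 ht1
          rwa [add_assoc] at this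
      _ = (∑ x : Fin n → X, tensorPow T n x * Real.exp (-t * F x)) * Real.exp s := by
          rw [Finset.sum_mul]; exact Finset.sum_congr rfl fun x _ => by ring
      _ ≤ Real.exp (-t * ∑ x, tensorPow P n x * F x + n * s) * Real.exp s :=
          mul_le_mul_of_nonneg_right (ih F hFlip) (Real.exp_pos _).le
      _ = _ := by
          rw [← Real.exp_add, hF]; push_cast; ring_nf

end ProductDistributions

/-! ### Types and type classes -/

section Types

variable {X : Type*}

open Classical in
/-- The number of occurrences of the symbol `a` in the string `x`. -/
noncomputable def symbolCount {n : ℕ} (x : Fin n → X) (a : X) : ℕ :=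
  (Finset.univ.filter fun i => x i = a).card

theorem stringType_eq {n : ℕ} (x : Fin n → X) (a : X) :
    stringType x a = (symbolCount x a : ℝ) / n := rfl

theorem symbolCount_comp_perm {n : ℕ} (x : Fin n → X) (π : Equiv.Perm (Fin n)) :
    symbolCount (x ∘ π) = symbolCount x := by
  classical
  funext a
  exact Finset.card_equiv π (by simp)

theorem exists_perm_of_symbolCount_eq {n : ℕ} {x y : Fin n → X}
    (h : symbolCount x = symbolCount y) : ∃ π : Equiv.Perm (Fin n), x ∘ π = y := by
  classical
  have hcard : ∀ a, Nonempty ({i // y i = a} ≃ {i // x i = a}) := by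
    intro a
    refine ⟨Fintype.equivOfCardEq ?_⟩
    rw [Fintype.card_subtype, Fintype.card_subtype]
    exact (congrFun h a).symm
  let e := fun a => (hcard a).some
  refine ⟨(Equiv.sigmaFiberEquiv y).symm.trans
    ((Equiv.sigmaCongrRight fun a => e a).trans (Equiv.sigmaFiberEquiv x)), ?_⟩
  funext i
  exact (e (y i) ⟨i, rfl⟩).2

theorem symbolCount_le {n : ℕ} (x : Fin n → X) (a : X) : symbolCount x a ≤ n := by
  classical
  exact (Finset.card_le_univ _).trans (by simp)

variable [Fintype X]

theorem sum_symbolCount {n : ℕ} (x : Fin n → X) : ∑ a, symbolCount x a = n := by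
  classical
  have := Finset.card_eq_sum_card_fiberwise (s := Finset.univ) (t := Finset.univ) (f := x)
    (by simp)
  simpa [symbolCount] using this.symm

theorem stringType_mem {n : ℕ} (hn : 1 ≤ n) (x : Fin n → X) : stringType x ∈ ProbDist X := by
  refine ⟨fun a => by rw [stringType_eq]; positivity, ?_⟩
  simp only [stringType_eq, ← Finset.sum_div, ← Nat.cast_sum, sum_symbolCount]
  exact div_self (by positivity)

theorem sum_comp_eq_sum_symbolCount {n : ℕ} (x : Fin n → X) (φ : X → ℝ) :
    ∑ i, φ (x i) = ∑ a, symbolCount x a * φ a := by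
  classical
  rw [← Finset.sum_fiberwise' Finset.univ x φ]
  simp [symbolCount]

theorem prod_comp_eq_prod_symbolCount {n : ℕ} (x : Fin n → X) (φ : X → ℝ) :
    ∏ i, φ (x i) = ∏ a, φ a ^ symbolCount x a := by
  classical
  rw [← Finset.prod_fiberwise' Finset.univ x φ]
  simp [symbolCount]

open Classical in
/-- The type class of a string: all strings with the same symbol counts. -/
noncomputable def typeClass {n : ℕ} (x₀ : Fin n → X) : Finset (Fin n → X) :=
  Finset.univ.filter fun x => symbolCount x = symbolCount x₀

theorem mem_typeClass {n : ℕ} {x₀ x : Fin n → X} :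
    x ∈ typeClass x₀ ↔ symbolCount x = symbolCount x₀ := by
  simp [typeClass]

open Classical in
/-- The size of a type class is a multinomial coefficient: permuting `x₀` reaches every string of the
class, each of them through as many permutations as fix `x₀`. -/
theorem card_typeClass_mul {n : ℕ} (x₀ : Fin n → X) :
    (typeClass x₀).card * ∏ a, (symbolCount x₀ a).factorial = n.factorial := by
  have h1 := Finset.card_eq_sum_card_fiberwise (s := (Finset.univ : Finset (Equiv.Perm (Fin n))))
    (t := typeClass x₀) (f := fun π : Equiv.Perm (Fin n) => x₀ ∘ π)
    (fun π _ => by simpa [mem_typeClass] using symbolCount_comp_perm x₀ π)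
  have h2 : ∀ y ∈ typeClass x₀,
      (Finset.univ.filter fun π : Equiv.Perm (Fin n) => x₀ ∘ π = y).card =
        ∏ a, (symbolCount x₀ a).factorial := by
    intro y hy
    obtain ⟨σ, hσ⟩ := exists_perm_of_symbolCount_eq (mem_typeClass.1 hy).symm
    have h3 := DomMulAct.stabilizer_card x₀
    rw [Fintype.card_subtype] at h3
    simp only [Fintype.card_subtype] at h3
    simp only [symbolCount]
    rw [← h3]
    refine Finset.card_equiv (Equiv.mulRight σ⁻¹) fun π => ?_
    simp only [Finset.mem_filter, Finset.mem_univ, true_and, Equiv.coe_mulRight, ← hσ]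
    constructor
    · intro h
      funext i
      have := congrFun h (σ⁻¹ i)
      simpa using this
    · intro h
      funext i
      have := congrFun h (σ i)
      simpa using this
  rw [Finset.sum_congr rfl h2, Finset.sum_const, Finset.card_univ, Fintype.card_perm,
    Fintype.card_fin, smul_eq_mul] at h1
  exact h1.symm

open Classical in
theorem card_image_symbolCount_le (X : Type*) [Fintype X] (n : ℕ) :
    ((Finset.univ : Finset (Fin n → X)).image symbolCount).card ≤ (n + 1) ^ Fintype.card X := by
  calc _ ≤ (Fintype.piFinset fun _ : X => Finset.range (n + 1)).card := by
        refine Finset.card_le_card fun k hk => ?_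
        obtain ⟨x, -, rfl⟩ := Finset.mem_image.1 hk
        simpa [Fintype.mem_piFinset, Nat.lt_succ_iff] using symbolCount_le x
    _ = _ := by simp [Finset.card_univ]

/-- Pigeonhole over the polynomially many type classes. -/
theorem exists_typeClass_sum_ge {n : ℕ} (M : (Fin n → X) → ℝ) {m : ℝ}
    (hm : 0 < m) (h : m ≤ ∑ x, M x) :
    ∃ x₀ : Fin n → X, m / (n + 1 : ℝ) ^ Fintype.card X ≤ ∑ x ∈ typeClass x₀, M x := by
  classical
  by_contra! hcon
  set I := (Finset.univ : Finset (Fin n → X)).image symbolCount with hI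
  have h1 : ∑ x, M x = ∑ k ∈ I, ∑ x with symbolCount x = k, M x :=
    (Finset.sum_fiberwise_of_maps_to (fun x hx => Finset.mem_image_of_mem _ hx) _).symm
  have h2 : ∀ k ∈ I, ∑ x with symbolCount x = k, M x < m / (n + 1 : ℝ) ^ Fintype.card X := by
    intro k hk
    obtain ⟨x, -, rfl⟩ := Finset.mem_image.1 hk
    exact hcon x
  have hne : I.Nonempty := by
    rw [Finset.nonempty_iff_ne_empty]
    intro h0
    rw [h0, Finset.sum_empty] at h1
    linarith
  have h3 := Finset.sum_lt_sum_of_nonempty hne h2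
  rw [Finset.sum_const, nsmul_eq_mul, ← h1] at h3
  have h4 : (I.card : ℝ) ≤ (n + 1 : ℝ) ^ Fintype.card X := by
    exact_mod_cast card_image_symbolCount_le X n
  have h5 : (0 : ℝ) < (n + 1 : ℝ) ^ Fintype.card X := by positivity
  have h6 : (I.card : ℝ) * (m / (n + 1 : ℝ) ^ Fintype.card X) ≤ m := by
    calc _ ≤ (n + 1 : ℝ) ^ Fintype.card X * (m / (n + 1 : ℝ) ^ Fintype.card X) :=
          mul_le_mul_of_nonneg_right h4 (by positivity)
      _ = m := by field_simp
  linarith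

/-- Shannon entropy (in nats). -/
noncomputable def entropy (P : X → ℝ) : ℝ := ∑ a, Real.negMulLog (P a)

theorem tensorPow_stringType {n : ℕ} {x₀ x : Fin n → X} (hx : x ∈ typeClass x₀) :
    tensorPow (stringType x₀) n x = Real.exp (-(n * entropy (stringType x₀))) := by
  rw [tensorPow, prod_comp_eq_prod_symbolCount, mem_typeClass.1 hx, entropy, Finset.mul_sum,
    ← Finset.sum_neg_distrib, Real.exp_sum]
  refine Finset.prod_congr rfl fun a _ => ?_
  rcases Nat.eq_zero_or_pos (symbolCount x₀ a) with h0 | h0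
  · simp [stringType_eq, h0]
  · have hn : 0 < n := h0.trans_le (symbolCount_le x₀ a)
    have hT : 0 < stringType x₀ a := by rw [stringType_eq]; positivity
    have : -(n * Real.negMulLog (stringType x₀ a)) =
        Real.log (stringType x₀ a) * symbolCount x₀ a := by
      rw [Real.negMulLog]
      have : (symbolCount x₀ a : ℝ) = n * stringType x₀ a := by
        rw [stringType_eq]; field_simp
      rw [this]; ring
    rw [this, Real.exp_mul, Real.exp_log hT, Real.rpow_natCast]

theorem pow_mul_factorial_le (k v : ℕ) : k ^ v * k.factorial ≤ k ^ k * v.factorial := by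
  rcases le_total k v with h | h
  · have h1 := Nat.factorial_mul_pow_sub_le_factorial h
    calc k ^ v * k.factorial = k ^ k * (k.factorial * k ^ (v - k)) := by
          rw [← Nat.sub_add_cancel h, pow_add]; simp; ring
      _ ≤ _ := Nat.mul_le_mul_left _ h1
  · have h1 : k.factorial ≤ v.factorial * k ^ (k - v) := by
      have := Nat.factorial_mul_descFactorial (Nat.sub_le k v)
      have h2 := Nat.descFactorial_le_pow k (k - v)
      rw [Nat.sub_sub_self h] at this
      rw [← this]
      exact Nat.mul_le_mul_left _ h2
    calc k ^ v * k.factorial ≤ k ^ v * (v.factorial * k ^ (k - v)) := Nat.mul_le_mul_left _ h1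
      _ = k ^ k * v.factorial := by
          rw [mul_left_comm, ← pow_add, Nat.add_sub_cancel' h, mul_comm]

/-- Among all type classes, that of `x₀` is the most likely one under the i.i.d. distribution whose
marginal is the type of `x₀`. -/
theorem sum_tensorPow_stringType_le {n : ℕ} (x₀ y : Fin n → X) :
    ∑ x ∈ typeClass y, tensorPow (stringType x₀) n x ≤
      ∑ x ∈ typeClass x₀, tensorPow (stringType x₀) n x := by
  have key : ∀ z : Fin n → X, ∑ x ∈ typeClass z, tensorPow (stringType x₀) n x =
      (typeClass z).card * ((∏ a, (symbolCount x₀ a : ℝ) ^ symbolCount z a) / (n : ℝ) ^ n) := by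
    intro z
    rw [← nsmul_eq_mul, ← Finset.sum_const]
    refine Finset.sum_congr rfl fun x hx => ?_
    rw [tensorPow, prod_comp_eq_prod_symbolCount, mem_typeClass.1 hx]
    simp only [stringType_eq, div_pow, Finset.prod_div_distrib, Finset.prod_pow_eq_pow_sum,
      sum_symbolCount]
  rw [key, key, ← mul_div_assoc, ← mul_div_assoc]
  refine div_le_div_of_nonneg_right ?_ (by positivity)
  have hy : ((typeClass y).card : ℝ) * ∏ a, ((symbolCount y a).factorial : ℝ) = n.factorial := by
    exact_mod_cast card_typeClass_mul y
  have hx : ((typeClass x₀).card : ℝ) * ∏ a, ((symbolCount x₀ a).factorial : ℝ) =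
      n.factorial := by
    exact_mod_cast card_typeClass_mul x₀
  have hprod : (∏ a, (symbolCount x₀ a : ℝ) ^ symbolCount y a) *
      ∏ a, ((symbolCount x₀ a).factorial : ℝ) ≤
      (∏ a, (symbolCount x₀ a : ℝ) ^ symbolCount x₀ a) *
      ∏ a, ((symbolCount y a).factorial : ℝ) := by
    rw [← Finset.prod_mul_distrib, ← Finset.prod_mul_distrib]
    refine Finset.prod_le_prod (fun a _ => by positivity) fun a _ => ?_
    exact_mod_cast pow_mul_factorial_le _ _
  have hFy : (0 : ℝ) < ∏ a, ((symbolCount y a).factorial : ℝ) :=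
    Finset.prod_pos fun a _ => by positivity
  have hFx : (0 : ℝ) < ∏ a, ((symbolCount x₀ a).factorial : ℝ) :=
    Finset.prod_pos fun a _ => by positivity
  have hN : (0 : ℝ) ≤ n.factorial := by positivity
  refine le_of_mul_le_mul_right (a := (∏ a, ((symbolCount y a).factorial : ℝ)) *
    ∏ a, ((symbolCount x₀ a).factorial : ℝ)) ?_ (mul_pos hFy hFx)
  have := mul_le_mul_of_nonneg_left hprod hN
  nth_rewrite 1 [← hy] at this
  nth_rewrite 1 [← hx] at this
  linarith

/-- The i.i.d. distribution whose marginal is a type gives the corresponding type class a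
probability that is at least inverse polynomial. -/
theorem le_sum_tensorPow_stringType {n : ℕ} (hn : 1 ≤ n) (x₀ : Fin n → X) :
    1 / (n + 1 : ℝ) ^ Fintype.card X ≤
      ∑ x ∈ typeClass x₀, tensorPow (stringType x₀) n x := by
  obtain ⟨y, hy⟩ := exists_typeClass_sum_ge (tensorPow (stringType x₀) n) one_pos
    (tensorPow_mem (stringType_mem hn x₀) n).2.ge
  exact hy.trans (sum_tensorPow_stringType_le x₀ y)

end Types

/-! ### Minimax and overlap -/

section Minimax

open scoped Pointwise

variable {Z : Type*} [Fintype Z]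

theorem sum_mul_le_of_mem_convexHull {S : Set (Z → ℝ)} {A : Z → ℝ} {m : ℝ}
    (h : ∀ Q ∈ S, ∑ z, A z * Q z ≤ m) {Q : Z → ℝ} (hQ : Q ∈ convexHull ℝ S) :
    ∑ z, A z * Q z ≤ m := by
  have hlin : IsLinearMap ℝ fun Q : Z → ℝ => ∑ z, A z * Q z :=
    ⟨fun x y => by simp [mul_add, Finset.sum_add_distrib],
      fun c x => by simp [Finset.mul_sum, mul_left_comm]⟩
  exact convexHull_min (t := {Q : Z → ℝ | ∑ z, A z * Q z ≤ m}) h (convex_halfSpace_le hlin m) hQ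

theorem convexHull_subset_probDist {S : Set (Z → ℝ)} (hS : S ⊆ ProbDist Z) :
    convexHull ℝ S ⊆ ProbDist Z :=
  convexHull_min hS (convex_stdSimplex ℝ Z)

/-- Von Neumann's minimax theorem for a bilinear payoff on a cube and a convex set. -/
theorem exists_forall_lt_of_forall_exists_lt {V : Set (Z → ℝ)} (hV : Convex ℝ V) {t : ℝ}
    (h : ∀ A ∈ Set.Icc (0 : Z → ℝ) 1, ∃ v ∈ V, t < ∑ z, A z * v z) :
    ∃ v ∈ V, ∀ A ∈ Set.Icc (0 : Z → ℝ) 1, t < ∑ z, A z * v z := by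
  have hcont : ∀ v : Z → ℝ, Continuous fun A : Z → ℝ => ∑ z, A z * v z := fun v => by fun_prop
  have hcont' : ∀ A : Z → ℝ, Continuous fun v : Z → ℝ => ∑ z, A z * v z := fun v => by fun_prop
  have hlin : ∀ v : Z → ℝ, IsLinearMap ℝ fun A : Z → ℝ => ∑ z, A z * v z := fun v =>
    ⟨fun x y => by simp [add_mul, Finset.sum_add_distrib],
      fun c x => by simp [Finset.mul_sum, mul_assoc]⟩
  have hlin' : ∀ A : Z → ℝ, IsLinearMap ℝ fun v : Z → ℝ => ∑ z, A z * v z := fun v =>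
    ⟨fun x y => by simp [mul_add, Finset.sum_add_distrib],
      fun c x => by simp [Finset.mul_sum, mul_left_comm]⟩
  have hK : IsCompact (Set.Icc (0 : Z → ℝ) 1) := isCompact_Icc
  obtain ⟨s, hs⟩ := hK.elim_finite_subcover (fun v : V => {A | t < ∑ z, A z * (v : Z → ℝ) z})
    (fun v => isOpen_lt continuous_const (hcont v))
    (fun A hA => by
      obtain ⟨v, hv, hlt⟩ := h A hA
      exact Set.mem_iUnion.2 ⟨⟨v, hv⟩, hlt⟩)
  refine Sion.exists_lt_iInf_of_lt_iInf_of_finite (X := Set.Icc (0 : Z → ℝ) 1) (Y := V)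
    (f := fun A v => ∑ z, A z * v z) (s := Subtype.val '' (s : Set V))
    ⟨0, le_rfl, zero_le_one⟩ hK (fun v _ => (hcont v).continuousOn.lowerSemicontinuousOn)
    (fun v _ => ((hlin v).mk' _).convexOn (convex_Icc 0 1) |>.quasiconvexOn) hV
    (fun A _ => (hcont' A).continuousOn.upperSemicontinuousOn)
    (fun A _ => ((hlin' A).mk' _).concaveOn hV |>.quasiconcaveOn) (convex_Icc 0 1)
    (s.finite_toSet.image _) ?_ ?_
  · rintro _ ⟨v, -, rfl⟩
    exact v.2
  · intro A hA
    obtain ⟨v, hv, hlt⟩ : ∃ v ∈ s, t < ∑ z, A z * (v : Z → ℝ) z := by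
      simpa only [Set.mem_iUnion, exists_prop, Set.mem_ofPred_eq] using hs hA
    exact ⟨v, ⟨v, hv, rfl⟩, hlt⟩

/-- If the minimal type II error is larger than `b`, then some pair of mixtures of null and
alternative distributions has a large overlap at the scale `ε / b`. -/
theorem exists_sum_min_gt {R S : Set (Z → ℝ)} (hR : R ⊆ ProbDist Z)
    (hS : S ⊆ ProbDist Z) {ε b : ℝ} (hε : 0 < ε)
    (hb : 0 < b) (h : ENNReal.ofReal b < minTypeII ε R S) :
    ∃ P ∈ convexHull ℝ R, ∃ Q ∈ convexHull ℝ S, ε < ∑ z, min (P z) (ε / b * Q z) := by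
  have hκ : 0 < ε / b := div_pos hε hb
  have alt : ∀ A ∈ Set.Icc (0 : Z → ℝ) 1,
      (∃ P ∈ R, ε < ∑ z, (1 - A z) * P z) ∨ ∃ Q ∈ S, b < ∑ z, A z * Q z := by
    intro A hA
    by_cases hI : typeIError R A ≤ ENNReal.ofReal ε
    · right
      have h1 : ENNReal.ofReal b < typeIIError S A :=
        h.trans_le (iInf₂_le A ⟨fun z => ⟨hA.1 z, hA.2 z⟩, hI⟩)
      simp only [typeIIError, lt_iSup_iff] at h1
      obtain ⟨Q, hQ, hlt⟩ := h1
      exact ⟨Q, hQ, lt_of_not_ge fun hle => hlt.not_ge (ENNReal.ofReal_le_ofReal hle)⟩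
    · left
      simp only [not_le, typeIError, lt_iSup_iff] at hI
      obtain ⟨P, hP, hlt⟩ := hI
      exact ⟨P, hP, lt_of_not_ge fun hle => hlt.not_ge (ENNReal.ofReal_le_ofReal hle)⟩
  obtain ⟨P₀, hP₀⟩ : R.Nonempty := by
    rcases alt 0 ⟨le_rfl, zero_le_one⟩ with ⟨P, hP, -⟩ | ⟨Q, -, hlt⟩
    · exact ⟨P, hP⟩
    · simp at hlt; linarith
  obtain ⟨Q₀, hQ₀⟩ : S.Nonempty := by
    rcases alt 1 ⟨zero_le_one, le_rfl⟩ with ⟨P, -, hlt⟩ | ⟨Q, hQ, -⟩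
    · simp at hlt; linarith
    · exact ⟨Q, hQ⟩
  have hV : Convex ℝ ((ε / b) • convexHull ℝ S - convexHull ℝ R) :=
    ((convex_convexHull ℝ S).smul _).sub (convex_convexHull ℝ R)
  have expand : ∀ A P Q : Z → ℝ, ∑ z, A z * ((ε / b) • Q - P) z =
      ε / b * ∑ z, A z * Q z - ∑ z, A z * P z := by
    intro A P Q
    simp only [Pi.sub_apply, Pi.smul_apply, smul_eq_mul, mul_sub, Finset.sum_sub_distrib,
      Finset.mul_sum]
    congr 1
    exact Finset.sum_congr rfl fun z _ => by ring
  obtain ⟨v, hv, hlt⟩ := exists_forall_lt_of_forall_exists_lt hV (t := ε - 1) (by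
    intro A hA
    rcases alt A hA with ⟨P, hP, hlt⟩ | ⟨Q, hQ, hlt⟩
    · refine ⟨(ε / b) • Q₀ - P, Set.sub_mem_sub
        (Set.smul_mem_smul_set (subset_convexHull ℝ S hQ₀)) (subset_convexHull ℝ R hP), ?_⟩
      rw [expand]
      simp only [sub_mul, one_mul, Finset.sum_sub_distrib, (hR hP).2] at hlt
      have : 0 ≤ ε / b * ∑ z, A z * Q₀ z := mul_nonneg hκ.le
        (Finset.sum_nonneg fun z _ => mul_nonneg (hA.1 z) ((hS hQ₀).1 z))
      linarith
    · refine ⟨(ε / b) • Q - P₀, Set.sub_mem_sub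
        (Set.smul_mem_smul_set (subset_convexHull ℝ S hQ)) (subset_convexHull ℝ R hP₀), ?_⟩
      rw [expand]
      have h1 : ε < ε / b * ∑ z, A z * Q z := by
        calc ε = ε / b * b := by field_simp
          _ < _ := mul_lt_mul_of_pos_left hlt hκ
      have h2 : ∑ z, A z * P₀ z ≤ ∑ z, P₀ z := Finset.sum_le_sum fun z _ =>
        mul_le_of_le_one_left ((hR hP₀).1 z) (hA.2 z)
      rw [(hR hP₀).2] at h2
      linarith)
  obtain ⟨_, ⟨Q, hQ, rfl⟩, P, hP, rfl⟩ := hv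
  refine ⟨P, hP, Q, hQ, ?_⟩
  classical
  -- The optimal test accepts where `ε / b * Q ≤ P`.
  have h1 := hlt (fun z => if ε / b * Q z ≤ P z then 1 else 0)
    ⟨fun z => by dsimp only; split_ifs <;> simp, fun z => by dsimp only; split_ifs <;> simp⟩
  have h2 : ∑ z, min (P z) (ε / b * Q z) =
      1 + ∑ z, (if ε / b * Q z ≤ P z then 1 else 0) * ((ε / b) • Q - P) z := by
    refine Eq.trans ?_ (congrArg (· + _) (convexHull_subset_probDist hR hP).2)
    rw [← Finset.sum_add_distrib]
    refine Finset.sum_congr rfl fun z _ => ?_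
    by_cases hz : ε / b * Q z ≤ P z
    · simp [hz]
    · simp [hz, (not_le.1 hz).le]
  rw [h2]
  linarith

end Minimax

/-! ### Converse bound -/

section Converse

variable {Z : Type*} [Fintype Z]

theorem sub_le_mul_log_div {x y : ℝ} (hx : 0 ≤ x) (hy : 0 ≤ y) (h : y = 0 → x = 0) :
    x - y ≤ x * Real.log (x / y) := by
  rcases hx.eq_or_lt with rfl | hx
  · simpa using hy
  · have hy : 0 < y := lt_of_le_of_ne hy fun h0 => hx.ne' (h h0.symm)
    have h1 := Real.one_sub_inv_le_log_of_pos (div_pos hx hy)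
    rw [inv_div] at h1
    have h2 := mul_le_mul_of_nonneg_left h1 hx.le
    have h3 : x * (1 - y / x) = x - y := by field_simp
    linarith

/-- A test that accepts `P` with probability at least `1 - ε` and `Q` with probability at most `b`
bounds the relative entropy of `P` and `Q` from below. -/
theorem mul_log_inv_le_sum {P Q A : Z → ℝ} (hP : P ∈ ProbDist Z) (hQ : Q ∈ ProbDist Z)
    (hPQ : ∀ z, Q z = 0 → P z = 0) (hA : ∀ z, A z ∈ Set.Icc (0 : ℝ) 1) {ε b : ℝ}
    (hb : 0 < b) (hb1 : b ≤ 1) (hAP : ∑ z, (1 - A z) * P z ≤ ε) (hAQ : ∑ z, A z * Q z ≤ b) :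
    (1 - ε) * Real.log b⁻¹ ≤ ∑ z, P z * Real.log (P z / Q z) + Real.log 2 := by
  -- Variational bound with the function `s A`, for which `∑ z, Q z * exp (s * A z) ≤ 2`.
  set s := Real.log b⁻¹ with hs
  have hs0 : 0 ≤ s := Real.log_nonneg (one_le_inv_iff₀.2 ⟨hb, hb1⟩)
  have hes : Real.exp s = b⁻¹ := Real.exp_log (inv_pos.2 hb)
  have hexp : ∀ z, Real.exp (s * A z) ≤ 1 + A z * (b⁻¹ - 1) := by
    intro z
    have := convexOn_exp.2 (Set.mem_univ (0 : ℝ)) (Set.mem_univ s)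
      (sub_nonneg.2 (hA z).2) (hA z).1 (by ring)
    simp only [smul_eq_mul, mul_zero, zero_add, Real.exp_zero, mul_one, hes] at this
    rw [mul_comm s]
    linarith
  have hterm : ∀ z, P z - Q z * Real.exp (s * A z) / 2 ≤
      P z * Real.log (P z / Q z) - s * (A z * P z) + Real.log 2 * P z := by
    intro z
    have h1 := sub_le_mul_log_div (hP.1 z)
      (y := Q z * Real.exp (s * A z) / 2)
      (by have := hQ.1 z; positivity)
      (fun h0 => hPQ z (by simpa using h0))
    rcases (hP.1 z).eq_or_lt with h0 | h0
    · rw [← h0] at h1 ⊢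
      simpa using h1
    · have hq : 0 < Q z := lt_of_le_of_ne (hQ.1 z) fun h => h0.ne' (hPQ z h.symm)
      have h2 : Real.log (P z / (Q z * Real.exp (s * A z) / 2)) =
          Real.log (P z / Q z) - s * A z + Real.log 2 := by
        rw [Real.log_div h0.ne' (by positivity), Real.log_div (by positivity) two_ne_zero,
          Real.log_mul hq.ne' (Real.exp_pos _).ne', Real.log_exp, Real.log_div h0.ne' hq.ne']
        ring
      rw [h2] at h1
      linarith
  have hsum := Finset.sum_le_sum fun z (_ : z ∈ Finset.univ) => hterm z
  simp only [Finset.sum_add_distrib, Finset.sum_sub_distrib, ← Finset.mul_sum, hP.2,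
    ← Finset.sum_div] at hsum
  have hQe : ∑ z, Q z * Real.exp (s * A z) ≤ 2 := by
    calc _ ≤ ∑ z, (Q z + (b⁻¹ - 1) * (A z * Q z)) := Finset.sum_le_sum fun z _ => by
          have := mul_le_mul_of_nonneg_left (hexp z) (hQ.1 z)
          linarith
      _ = 1 + (b⁻¹ - 1) * ∑ z, A z * Q z := by
          rw [Finset.sum_add_distrib, hQ.2, ← Finset.mul_sum]
      _ ≤ 1 + (b⁻¹ - 1) * b := by
          have := mul_le_mul_of_nonneg_left hAQ
            (sub_nonneg.2 (one_le_inv_iff₀.2 ⟨hb, hb1⟩))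
          linarith
      _ ≤ 2 := by
          have : (b⁻¹ - 1) * b = 1 - b := by field_simp
          linarith
  simp only [sub_mul, one_mul, Finset.sum_sub_distrib, hP.2] at hAP
  nlinarith

/-- Every mixture `Q` of alternatives bounds the minimal type II error from below through its relative
entropy from a single null distribution. -/
theorem exp_neg_le_minTypeII {R S : Set (Z → ℝ)} (hS : S ⊆ ProbDist Z) {ε : ℝ} (hε0 : 0 < ε)
    (hε1 : ε < 1) {P Q : Z → ℝ} (hPR : P ∈ R) (hP : P ∈ ProbDist Z) (hQ : Q ∈ convexHull ℝ S)
    (hPQ : ∀ z, Q z = 0 → P z = 0) :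
    ENNReal.ofReal (Real.exp (-((∑ z, P z * Real.log (P z / Q z) + Real.log 2) / (1 - ε)))) ≤
      minTypeII ε R S := by
  have hQ' := convexHull_subset_probDist hS hQ
  set D := ∑ z, P z * Real.log (P z / Q z) + Real.log 2 with hD
  refine le_iInf₂ fun A hA => ?_
  by_contra! hlt
  set b' := Real.exp (-(D / (1 - ε))) with hb'
  have hD0 : 0 ≤ D := by
    have := mul_log_inv_le_sum hP hQ' hPQ (A := 0) (ε := 1) (b := 1) (by simp) one_pos le_rfl
      (by simp [hP.2]) (by simp)
    simpa using this
  have hI : ∑ z, (1 - A z) * P z ≤ ε := by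
    have h1 : ENNReal.ofReal (∑ z, (1 - A z) * P z) ≤ ENNReal.ofReal ε :=
      (le_iSup₂ (f := fun P (_ : P ∈ R) => ENNReal.ofReal (∑ z, (1 - A z) * P z)) P hPR).trans
        hA.2
    exact (ENNReal.ofReal_le_ofReal_iff hε0.le).1 h1
  have hII : ∃ b, 0 < b ∧ b < b' ∧ ∑ z, A z * Q z ≤ b := by
    obtain ⟨c, hc0, hc1⟩ := exists_between hlt
    have hcb : c.toReal < b' := by
      have h1 := (ENNReal.toReal_lt_toReal (ne_top_of_lt hc1) ENNReal.ofReal_ne_top).2 hc1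
      rwa [ENNReal.toReal_ofReal (Real.exp_pos _).le] at h1
    refine ⟨c.toReal, ENNReal.toReal_pos (bot_le.trans_lt hc0).ne' (ne_top_of_lt hc1), hcb,
      sum_mul_le_of_mem_convexHull (fun Q' hQ' => ?_) hQ⟩
    have h1 : ENNReal.ofReal (∑ z, A z * Q' z) ≤ c :=
      (le_iSup₂ (f := fun Q (_ : Q ∈ S) => ENNReal.ofReal (∑ z, A z * Q z)) Q' hQ').trans hc0.le
    exact (ENNReal.ofReal_le_iff_le_toReal (ne_top_of_lt hc1)).1 h1
  obtain ⟨b, hb0, hbb', hbQ⟩ := hII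
  have h1ε : 0 < 1 - ε := by linarith
  have hb1 : b ≤ 1 := hbb'.le.trans (Real.exp_le_one_iff.2 (by
    have := div_nonneg hD0 h1ε.le
    linarith))
  have h1 := mul_log_inv_le_sum hP hQ' hPQ hA.1 hb0 hb1 hI hbQ
  rw [← hD, Real.log_inv, mul_comm, ← le_div_iff₀ h1ε] at h1
  have h2 : Real.log b < -(D / (1 - ε)) := by
    rw [Real.log_lt_iff_lt_exp hb0]
    exact hbb'
  linarith

variable {X : Type*} [Fintype X]

theorem liminf_minTypeII_le {R S : Family X} (hR : IsHypothesis R) (hS : IsHypothesis S)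
    (hpow : ClosedUnderTensorPowers R) {P : X → ℝ} (hP : P ∈ R.base) {c η : ℝ} (hη : 0 < η)
    (hc : liminf (fun n : ℕ => ((1 / (n : ℝ) : ℝ) : EReal) *
      ⨅ Q ∈ convexHull ℝ (S n), relEntropy (tensorPow P n) Q) atTop < c)
    {ε : ℝ} (hε0 : 0 < ε) (hε1 : ε < 1) :
    liminf (fun n : ℕ => ((1 / (n : ℝ) : ℝ) : EReal) * -(minTypeII ε (R n) (S n)).log) atTop ≤
      ((c / (1 - ε) + η : ℝ) : EReal) := by
  have h1ε : 0 < 1 - ε := by linarith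
  have hsmall : ∀ᶠ n : ℕ in atTop, Real.log 2 / (1 - ε) / n ≤ η :=
    (tendsto_const_div_atTop_nhds_zero_nat _).eventually (eventually_le_nhds hη)
  refine liminf_le_of_frequently_le' ?_
  refine ((frequently_lt_of_liminf_lt (by isBoundedDefault) hc).and_eventually
    (hsmall.and (eventually_ge_atTop 1))).mono ?_
  rintro n ⟨hlt, hn, hn1⟩
  have hn0 : (0 : ℝ) < n := by exact_mod_cast hn1
  obtain ⟨Q, hQ, hD⟩ : ∃ Q ∈ convexHull ℝ (S n), relEntropy (tensorPow P n) Q < (c * n : ℝ) := by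
    by_contra! hcon
    have h1 : ((c * n : ℝ) : EReal) ≤
        ⨅ Q ∈ convexHull ℝ (S n), relEntropy (tensorPow P n) Q := le_iInf₂ hcon
    have h2 := mul_le_mul_of_nonneg_left h1
      (a := ((1 / (n : ℝ) : ℝ) : EReal)) (by exact_mod_cast (one_div_pos.2 hn0).le)
    rw [← EReal.coe_mul] at h2
    have h3 : 1 / (n : ℝ) * (c * n) = c := by field_simp
    rw [h3] at h2
    exact absurd hlt h2.not_gt
  have hPn := hpow P hP n hn1
  rw [relEntropy] at hD
  split_ifs at hD with hsupp
  · have hβ := exp_neg_le_minTypeII (hS n hn1) hε0 hε1 hPn (hR n hn1 hPn) hQ hsupp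
    have hD' := EReal.coe_lt_coe_iff.1 hD
    set D := ∑ z, tensorPow P n z * Real.log (tensorPow P n z / Q z) with hDdef
    have h1 := ENNReal.log_monotone hβ
    rw [ENNReal.log_ofReal_of_pos (Real.exp_pos _), Real.log_exp] at h1
    have h2 : -(minTypeII ε (R n) (S n)).log ≤ (((D + Real.log 2) / (1 - ε) : ℝ) : EReal) := by
      rw [EReal.neg_le]
      simpa using h1
    calc _ ≤ ((1 / (n : ℝ) : ℝ) : EReal) * (((D + Real.log 2) / (1 - ε) : ℝ) : EReal) :=
          mul_le_mul_of_nonneg_left h2 (by exact_mod_cast (one_div_pos.2 hn0).le)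
      _ ≤ _ := by
          rw [← EReal.coe_mul, EReal.coe_le_coe_iff]
          have h3 : 1 / (n : ℝ) * ((D + Real.log 2) / (1 - ε)) =
              D / n / (1 - ε) + Real.log 2 / (1 - ε) / n := by field_simp
          have h4 : D / n ≤ c := (div_le_iff₀ hn0).2 hD'.le
          have h5 := div_le_div_of_nonneg_right h4 h1ε.le
          linarith
  · exact absurd hD (by simp)

end Converse

/-! ### Filtering implies type stability -/

section Filtering

variable {X : Type*} [Fintype X]

omit [Fintype X] in
theorem PermSymmetric.closedUnderPerms {F : Family X} (h : PermSymmetric F) :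
    ClosedUnderPerms F := by
  intro n hn Q hQ π
  rwa [show (fun x => Q (x ∘ π)) = Q from funext fun x => h n hn Q hQ π x]

theorem sum_comp_perm {n : ℕ} (π : Equiv.Perm (Fin n)) (f : (Fin n → X) → ℝ) :
    ∑ x : Fin n → X, f (x ∘ π) = ∑ x, f x :=
  (Equiv.arrowCongr π.symm (Equiv.refl X)).sum_comp f

theorem jointLastOutput_nonneg {m n : ℕ} {W : Matrix X (Fin m) ℝ} (hW : IsChannel W)
    {Q : (Fin (n + 1) → X) → ℝ} (hQ : ∀ x, 0 ≤ Q x) (y : Fin m) (x : Fin n → X) :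
    0 ≤ jointLastOutput W Q y x :=
  Finset.sum_nonneg fun a _ => mul_nonneg (hQ _) ((hW a).1 y)

/-- If `g` has expectation at most `B` under every distribution in `F n`, the same bound holds after
conditioning `Q ∈ F (n + 1)` on the output of the filtering channel, hence for every nonnegative
reweighting of the outputs. -/
theorem sum_mul_le_of_filtering {F : Family X} {m : ℕ} {W : Matrix X (Fin m) ℝ}
    (hW : IsChannel W) {n : ℕ} {Q : (Fin (n + 1) → X) → ℝ} (hQ : ∀ x, 0 ≤ Q x)
    (hfil : ∀ y : Fin m, 0 < ∑ x, jointLastOutput W Q y x → condLastOutput W Q y ∈ F n)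
    {g : (Fin n → X) → ℝ} {B : ℝ} (hg : ∀ Q' ∈ F n, ∑ x, Q' x * g x ≤ B)
    {w : Fin m → ℝ} (hw : ∀ y, 0 ≤ w y) :
    ∑ x : Fin n → X, ∑ a, Q (Fin.snoc (α := fun _ => X) x a) * (g x * ∑ y, W a y * w y) ≤
      B * ∑ x : Fin n → X, ∑ a, Q (Fin.snoc (α := fun _ => X) x a) * ∑ y, W a y * w y := by
  have expand : ∀ g : (Fin n → X) → ℝ,
      ∑ x : Fin n → X, ∑ a, Q (Fin.snoc (α := fun _ => X) x a) * (g x * ∑ y, W a y * w y) =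
        ∑ y, w y * ∑ x, jointLastOutput W Q y x * g x := by
    intro g
    simp only [jointLastOutput, Finset.mul_sum, Finset.sum_mul]
    calc _ = ∑ x : Fin n → X, ∑ y, ∑ a,
          Q (Fin.snoc (α := fun _ => X) x a) * (g x * (W a y * w y)) :=
          Finset.sum_congr rfl fun x _ => Finset.sum_comm
      _ = _ := by
          rw [Finset.sum_comm]
          refine Finset.sum_congr rfl fun y _ => Finset.sum_congr rfl fun x _ =>
            Finset.sum_congr rfl fun a _ => by ring
  have h1 := expand fun _ => 1
  simp only [one_mul, mul_one] at h1
  rw [expand g, h1, Finset.mul_sum]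
  refine Finset.sum_le_sum fun y _ => ?_
  rw [mul_left_comm]
  refine mul_le_mul_of_nonneg_left ?_ (hw y)
  have hnn := jointLastOutput_nonneg hW hQ y
  rcases (Finset.sum_nonneg fun x _ => hnn x : 0 ≤ ∑ x, jointLastOutput W Q y x).eq_or_lt with
    h0 | h0
  · have hz := (Finset.sum_eq_zero_iff_of_nonneg fun x _ => hnn x).1 h0.symm
    rw [← h0, mul_zero]
    exact (Finset.sum_eq_zero fun x hx => by rw [hz x hx, zero_mul]).le
  · have h2 := hg _ (hfil y h0)
    simp only [condLastOutput, div_mul_eq_mul_div] at h2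
    rwa [← Finset.sum_div, div_le_iff₀ h0] at h2

/-- Under filtering, the marginal of the first symbol of a member of the family is a mixture of
members of `F 1`. -/
theorem sum_mul_apply_zero_le {F : Family X} (hF : IsHypothesis F) {m : ℕ}
    {W : Matrix X (Fin m) ℝ} (hW : IsChannel W)
    (hfil : ∀ n : ℕ, 1 ≤ n → ∀ Q ∈ F (n + 1), ∀ y : Fin m,
      0 < ∑ x, jointLastOutput W Q y x → condLastOutput W Q y ∈ F n)
    {H : X → ℝ} {B : ℝ} (hB : ∀ P ∈ F.base, ∑ a, P a * H a ≤ B) (n : ℕ) :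
    ∀ Q ∈ F (n + 1), ∑ x, Q x * H (x 0) ≤ B := by
  induction n with
  | zero =>
    intro Q hQ
    have h1 := hB (fun a => Q (fun _ => a)) (by
      rw [Family.base, Set.mem_ofPred_eq]
      convert hQ using 3 with x
      funext i
      exact congrArg x (Subsingleton.elim (α := Fin 1) 0 i))
    refine le_of_eq_of_le ?_ h1
    refine ((Equiv.funUnique (Fin 1) X).symm.sum_comp _).symm.trans ?_
    rfl
  | succ n ih =>
    intro Q hQ
    have hQ' := hF _ (by omega) hQ
    have h1 := sum_mul_le_of_filtering (F := F) hW hQ'.1 (hfil (n + 1) (by omega) Q hQ) ih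
      (w := 1) (by simp)
    have h2 : ∀ a, ∑ y, W a y = 1 := fun a => (hW a).2
    simp only [Pi.one_apply, mul_one, h2, ← sum_snoc, hQ'.2] at h1
    rw [sum_snoc]
    have h3 : ∀ (x : Fin (n + 1) → X) (a : X),
        (Fin.snoc (α := fun _ => X) x a : Fin (n + 1 + 1) → X) 0 = x 0 := fun x a => by
      rw [← Fin.castSucc_zero, Fin.snoc_castSucc]
    simpa only [h3] using h1

/-- Exponential moments of a filtered family are controlled by its one-letter marginals. -/
theorem sum_mul_prod_le_pow {F : Family X} (hF : IsHypothesis F) (hperm : ClosedUnderPerms F)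
    {m : ℕ} {W : Matrix X (Fin m) ℝ} (hW : IsChannel W)
    (hfil : ∀ n : ℕ, 1 ≤ n → ∀ Q ∈ F (n + 1), ∀ y : Fin m,
      0 < ∑ x, jointLastOutput W Q y x → condLastOutput W Q y ∈ F n)
    {h : Fin m → ℝ} (hh : ∀ y, 0 ≤ h y) {B : ℝ} (hB0 : 0 ≤ B)
    (hB : ∀ P ∈ F.base, ∑ a, P a * ∑ y, W a y * h y ≤ B) {n : ℕ} (hn : 1 ≤ n) :
    ∀ Q ∈ F n, ∑ x, Q x * ∏ i, ∑ y, W (x i) y * h y ≤ B ^ n := by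
  have hmarg := sum_mul_apply_zero_le hF hW hfil hB
  induction n, hn using Nat.le_induction with
  | base =>
    intro Q hQ
    simpa using hmarg 0 Q hQ
  | succ n hn ih =>
    intro Q hQ
    have hQ' := hF _ (by omega) hQ
    have h1 := sum_mul_le_of_filtering (F := F) hW hQ'.1 (hfil n hn Q hQ) ih hh
    have h2 := hmarg n _ (hperm _ (by omega) Q hQ (Equiv.swap 0 (Fin.last n)))
    have h3 : ∑ x : Fin (n + 1) → X, Q x * ∑ y, W (x (Fin.last n)) y * h y ≤ B := by
      refine le_of_eq_of_le ?_ h2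
      rw [← sum_comp_perm (Equiv.swap 0 (Fin.last n))]
      simp
    rw [sum_snoc] at h3 ⊢
    simp only [Fin.snoc_last] at h3
    simp only [prod_snoc fun a => ∑ y, W a y * h y]
    calc _ ≤ _ := h1
      _ ≤ B ^ n * B := mul_le_mul_of_nonneg_left h3 (pow_nonneg hB0 n)
      _ = _ := (pow_succ B n).symm

theorem exp_sub_two_mul_sq_le {s : ℝ} (hs : |s| ≤ 1 / 2) : Real.exp (s - 2 * s ^ 2) ≤ 1 + s := by
  have h1 := abs_le.1 hs
  have hpos : 0 < 1 + s := by linarith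
  rw [← Real.le_log_iff_exp_le hpos]
  refine le_trans ?_ (Real.one_sub_inv_le_log_of_pos hpos)
  have : 1 - (1 + s)⁻¹ - (s - 2 * s ^ 2) = s ^ 2 * (1 + 2 * s) / (1 + s) := by
    field_simp; ring
  have h2 : 0 ≤ s ^ 2 * (1 + 2 * s) / (1 + s) :=
    div_nonneg (mul_nonneg (sq_nonneg s) (by linarith)) hpos.le
  linarith

theorem exists_mulVec_eq {m : ℕ} {W : Matrix X (Fin m) ℝ} (hW : W.rank = Fintype.card X)
    (g : X → ℝ) : ∃ l : Fin m → ℝ, ∀ a, ∑ y, W a y * l y = g a := by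
  have h1 : LinearMap.range W.mulVecLin = ⊤ := by
    apply Submodule.eq_top_of_finrank_eq
    rw [Module.finrank_fintype_fun_eq_card, ← hW]
    rfl
  obtain ⟨l, hl⟩ := LinearMap.range_eq_top.1 h1 g
  exact ⟨l, fun a => congrFun hl a⟩

omit [Fintype X] in
theorem convex_base {F : Family X} (h : Convex ℝ (F 1)) : Convex ℝ F.base :=
  h.linear_preimage (LinearMap.funLeft ℝ ℝ fun x : Fin 1 → X => x 0)

/-- A family closed under filtering and under permutations, with closed convex one-letter set, is
type stable: types away from the one-letter set have exponentially small probability. -/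
theorem typeStable_of_filtering {F : Family X} (hF : IsHypothesis F) (hclosed : IsClosed F.base)
    (hconv : Convex ℝ F.base) (hperm : ClosedUnderPerms F) (hfil : Filtering F) :
    TypeStable F := by
  rintro P hP ⟨K, hK, hfreq⟩
  by_contra hPF
  obtain ⟨m, W, hW, hrank, hfil⟩ := hfil
  obtain ⟨f, u, hfu, hfP⟩ := geometric_hahn_banach_closed_point hconv hclosed hPF
  classical
  set g : X → ℝ := fun a => f (fun j => if a = j then 1 else 0) with hg
  have hfg : ∀ P : X → ℝ, f P = ∑ a, P a * g a := by
    intro P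
    have := LinearMap.pi_apply_eq_sum_univ (f : (X → ℝ) →ₗ[ℝ] ℝ) P
    simpa [hg] using this
  obtain ⟨l, hl⟩ := exists_mulVec_eq hrank g
  obtain ⟨C, hC1, hCu, hCl, hCg⟩ : ∃ C : ℝ, 1 ≤ C ∧ |u| ≤ C ∧ (∀ y, |l y| ≤ C) ∧
      ∀ a, |g a| ≤ C := by
    refine ⟨1 + |u| + ∑ y, |l y| + ∑ a, |g a|, ?_, ?_, fun y => ?_, fun a => ?_⟩
    all_goals
      have h1 : 0 ≤ ∑ y, |l y| := Finset.sum_nonneg fun _ _ => abs_nonneg _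
      have h2 : 0 ≤ ∑ a, |g a| := Finset.sum_nonneg fun _ _ => abs_nonneg _
      have h3 := abs_nonneg u
    · linarith
    · linarith
    · have := Finset.single_le_sum (f := fun y => |l y|) (fun _ _ => abs_nonneg _)
        (Finset.mem_univ y)
      linarith
    · have := Finset.single_le_sum (f := fun a => |g a|) (fun _ _ => abs_nonneg _)
        (Finset.mem_univ a)
      linarith
  set γ := f P - u with hγ
  have hγ0 : 0 < γ := by linarith
  obtain ⟨t, ht0, htC, htγ⟩ : ∃ t : ℝ, 0 < t ∧ t * C ≤ 1 / 2 ∧ 2 * t * C ^ 2 ≤ γ / 4 := by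
    refine ⟨min (1 / (2 * C)) (γ / (8 * C ^ 2)), by positivity, ?_, ?_⟩
    · calc _ ≤ 1 / (2 * C) * C := mul_le_mul_of_nonneg_right (min_le_left _ _) (by positivity)
        _ = 1 / 2 := by field_simp
    · calc _ ≤ 2 * (γ / (8 * C ^ 2)) * C ^ 2 := by gcongr; exact min_le_right _ _
        _ = γ / 4 := by field_simp; norm_num
  have habs : ∀ r, |r| ≤ C → |t * r| ≤ 1 / 2 := fun r hr => by
    rw [abs_mul, abs_of_pos ht0]
    exact (mul_le_mul_of_nonneg_left hr ht0.le).trans htC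
  set δ := γ / (8 * C) with hδ
  have hδ0 : 0 < δ := by positivity
  have hH : ∀ a, ∑ y, W a y * (1 + t * l y) = 1 + t * g a := by
    intro a
    rw [← hl a, Finset.mul_sum]
    simp only [mul_add, mul_one, Finset.sum_add_distrib, (hW a).2]
    congr 1
    exact Finset.sum_congr rfl fun y _ => by ring
  have hB0 : 0 ≤ 1 + t * u := by linarith [(abs_le.1 (habs u hCu)).1]
  have key : ∀ n : ℕ, 1 ≤ n → ∀ Q ∈ F n,
      probTypeNear Q P δ ≤ Real.exp (-(t * γ / 2) * n) := by
    intro n hn Q hQ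
    have hQ' := hF n hn hQ
    have hn0 : (0 : ℝ) < n := by exact_mod_cast hn
    have h1 := sum_mul_prod_le_pow hF hperm hW hfil (h := fun y => 1 + t * l y)
      (fun y => by linarith [(abs_le.1 (habs _ (hCl y))).1]) hB0
      (fun P' hP' => by
        simp only [hH]
        simp only [mul_add, mul_one, Finset.sum_add_distrib]
        have h2 := hfu P' hP'
        rw [hfg] at h2
        have h3 : (fun x : Fin 1 → X => P' (x 0)) ∈ ProbDist (Fin 1 → X) := hF 1 le_rfl hP'
        have h4 : ∑ a, P' a = 1 := by
          rw [← h3.2]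
          exact (Equiv.funUnique (Fin 1) X).symm.sum_comp (fun x : Fin 1 → X => P' (x 0))
        rw [h4]
        have h5 : ∑ a, P' a * (t * g a) = t * ∑ a, P' a * g a := by
          rw [Finset.mul_sum]; exact Finset.sum_congr rfl fun a _ => by ring
        rw [h5]
        nlinarith) hn Q hQ
    simp only [hH] at h1
    have hprodnn : ∀ x : Fin n → X, 0 ≤ ∏ i, (1 + t * g (x i)) := fun x =>
      Finset.prod_nonneg fun i _ => by linarith [(abs_le.1 (habs _ (hCg (x i)))).1]
    have hprod : ∀ x : Fin n → X, tvDist (stringType x) P ≤ δ →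
        Real.exp (n * (t * (f P - γ / 4) - t * (γ / 4))) ≤ ∏ i, (1 + t * g (x i)) := by
      intro x hx
      calc _ ≤ Real.exp (∑ i, (t * g (x i) - 2 * (t * g (x i)) ^ 2)) := by
            refine Real.exp_le_exp.2 ?_
            have hsum : ∑ i, g (x i) = n * ∑ a, stringType x a * g a := by
              rw [sum_comp_eq_sum_symbolCount, Finset.mul_sum]
              refine Finset.sum_congr rfl fun a _ => ?_
              rw [stringType_eq]; field_simp
            have hlow : f P - γ / 4 ≤ ∑ a, stringType x a * g a := by
              have h2 : f P - ∑ a, stringType x a * g a ≤ C * ∑ a, |stringType x a - P a| := by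
                rw [hfg, ← Finset.sum_sub_distrib, Finset.mul_sum]
                refine Finset.sum_le_sum fun a _ => ?_
                calc P a * g a - stringType x a * g a
                    ≤ |(stringType x a - P a) * g a| := by
                      rw [← abs_neg]; exact le_trans (by ring_nf; rfl) (le_abs_self _)
                  _ ≤ _ := by
                      rw [abs_mul, mul_comm]
                      exact mul_le_mul_of_nonneg_right (hCg a) (abs_nonneg _)
              have h3 : ∑ a, |stringType x a - P a| ≤ 2 * δ := by
                rw [tvDist] at hx; linarith
              have h4 : C * (2 * δ) = γ / 4 := by rw [hδ]; field_simp; norm_num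
              have h5 := mul_le_mul_of_nonneg_left h3 (by linarith : (0 : ℝ) ≤ C)
              linarith
            have hsq : ∑ i, 2 * (t * g (x i)) ^ 2 ≤ n * (t * (γ / 4)) := by
              calc _ ≤ ∑ _i : Fin n, t * (γ / 4) := Finset.sum_le_sum fun i _ => by
                    have h2 : g (x i) ^ 2 ≤ C ^ 2 := sq_le_sq' (abs_le.1 (hCg _)).1
                      (abs_le.1 (hCg _)).2
                    have h3 : 2 * t * g (x i) ^ 2 ≤ γ / 4 :=
                      (mul_le_mul_of_nonneg_left h2 (by positivity)).trans htγ
                    nlinarith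
                _ = _ := by simp
            rw [Finset.sum_sub_distrib, ← Finset.mul_sum, hsum]
            have := mul_le_mul_of_nonneg_left hlow (mul_pos hn0 ht0).le
            linarith
        _ ≤ _ := by
            rw [Real.exp_sum]
            exact Finset.prod_le_prod (fun i _ => (Real.exp_pos _).le) fun i _ =>
              exp_sub_two_mul_sq_le (habs _ (hCg _))
    have h2 : probTypeNear Q P δ * Real.exp (n * (t * (f P - γ / 4) - t * (γ / 4))) ≤
        (1 + t * u) ^ n := by
      refine le_trans ?_ h1
      rw [probTypeNear, Finset.sum_mul]
      calc _ ≤ ∑ x with tvDist (stringType x) P ≤ δ, Q x * ∏ i, (1 + t * g (x i)) :=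
            Finset.sum_le_sum fun x hx => mul_le_mul_of_nonneg_left
              (hprod x (Finset.mem_filter.1 hx).2) (hQ'.1 x)
        _ ≤ _ := Finset.sum_le_sum_of_subset_of_nonneg (Finset.filter_subset _ _)
              fun x _ _ => mul_nonneg (hQ'.1 x) (hprodnn x)
    have h3 : (1 + t * u) ^ n ≤ Real.exp (n * (t * u)) := by
      rw [Real.exp_nat_mul]
      exact pow_le_pow_left₀ hB0 (by linarith [Real.add_one_le_exp (t * u)]) n
    have h4 := h2.trans h3
    rw [← le_div_iff₀ (Real.exp_pos _), ← Real.exp_sub] at h4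
    refine h4.trans (Real.exp_le_exp.2 (le_of_eq ?_))
    rw [hγ]; ring
  have hθ : 0 < t * γ / 2 := by positivity
  have hlim := (tendsto_rpow_mul_exp_neg_mul_atTop_nhds_zero K (t * γ / 2) hθ).comp
    tendsto_natCast_atTop_atTop
  obtain ⟨n, hn, hlt, hn1⟩ := ((hfreq δ hδ0).and_eventually
    ((hlim.eventually (gt_mem_nhds one_pos)).and (eventually_ge_atTop 1))).exists
  have hn0 : (0 : ℝ) < n := by exact_mod_cast hn1
  have h1 : ENNReal.ofReal (1 / (n : ℝ) ^ K) ≤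
      ENNReal.ofReal (Real.exp (-(t * γ / 2) * n)) :=
    hn.trans (iSup₂_le fun Q hQ => ENNReal.ofReal_le_ofReal (key n hn1 Q hQ))
  rw [ENNReal.ofReal_le_ofReal_iff (Real.exp_pos _).le,
    div_le_iff₀ (Real.rpow_pos_of_pos hn0 K)] at h1
  simp only [Function.comp_apply] at hlt
  linarith

end Filtering

/-! ### Blurring a type class -/

section Blurring

variable {X : Type*} [Fintype X]

omit [Fintype X] in
theorem perm_invariant_of_mem_convexHull {n : ℕ} {R : Set ((Fin n → X) → ℝ)}
    (hR : ∀ P ∈ R, ∀ π : Equiv.Perm (Fin n), ∀ x, P (x ∘ π) = P x) {P : (Fin n → X) → ℝ}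
    (hP : P ∈ convexHull ℝ R) (π : Equiv.Perm (Fin n)) (x : Fin n → X) : P (x ∘ π) = P x := by
  have h : convexHull ℝ R ⊆ {P | ∀ π : Equiv.Perm (Fin n), ∀ x, P (x ∘ π) = P x} := by
    refine convexHull_min hR fun P hP Q hQ a b _ _ _ π x => ?_
    simp only [Pi.add_apply, Pi.smul_apply, hP π x, hQ π x]
  exact h hP π x

omit [Fintype X] in
theorem comp_perm_mem_convexHull {n : ℕ} {S : Set ((Fin n → X) → ℝ)}
    (hS : ∀ Q ∈ S, ∀ π : Equiv.Perm (Fin n), (fun x => Q (x ∘ π)) ∈ S) {Q : (Fin n → X) → ℝ}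
    (hQ : Q ∈ convexHull ℝ S) (π : Equiv.Perm (Fin n)) :
    (fun x => Q (x ∘ π)) ∈ convexHull ℝ S :=
  convexHull_min (s := S) (t := (fun Q x => Q (x ∘ π)) ⁻¹' convexHull ℝ S)
    (fun Q hQ => subset_convexHull ℝ S (hS Q hQ π))
    ((convex_convexHull ℝ S).linear_preimage (LinearMap.funLeft ℝ ℝ fun x : Fin n → X => x ∘ π)) hQ

/-- Averaging over the permutations of the symbols stays in the convex hull of a permutation
invariant set, and spreads the mass of every type class uniformly. -/
theorem exists_symmetrization {n : ℕ} {S : Set ((Fin n → X) → ℝ)}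
    (hS : ∀ Q ∈ S, ∀ π : Equiv.Perm (Fin n), (fun x => Q (x ∘ π)) ∈ S) {Q : (Fin n → X) → ℝ}
    (hQ : Q ∈ convexHull ℝ S) :
    ∃ Q' ∈ convexHull ℝ S, (∀ (π : Equiv.Perm (Fin n)) x, Q' (x ∘ π) = Q' x) ∧
      ∀ x₀, ∑ x ∈ typeClass x₀, Q' x = ∑ x ∈ typeClass x₀, Q x := by
  classical
  set N : ℝ := (Fintype.card (Equiv.Perm (Fin n)) : ℝ) with hN
  have hN0 : 0 < N := by rw [hN]; exact_mod_cast Fintype.card_pos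
  refine ⟨∑ π : Equiv.Perm (Fin n), N⁻¹ • fun x => Q (x ∘ π), ?_, ?_, ?_⟩
  · refine (convex_convexHull ℝ S).sum_mem (fun _ _ => by positivity) ?_
      fun π _ => comp_perm_mem_convexHull hS hQ π
    simp only [Finset.sum_const, Finset.card_univ, nsmul_eq_mul, ← hN]
    exact mul_inv_cancel₀ hN0.ne'
  · intro σ x
    simp only [Finset.sum_apply, Pi.smul_apply]
    exact Equiv.sum_comp (Equiv.mulLeft σ) fun π : Equiv.Perm (Fin n) => N⁻¹ • Q (x ∘ π)
  · intro x₀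
    simp only [Finset.sum_apply, Pi.smul_apply]
    rw [Finset.sum_comm]
    have h : ∀ π : Equiv.Perm (Fin n),
        ∑ x ∈ typeClass x₀, N⁻¹ • Q (x ∘ π) = N⁻¹ * ∑ x ∈ typeClass x₀, Q x := by
      intro π
      rw [Finset.mul_sum]
      refine Finset.sum_equiv (Equiv.arrowCongr π.symm (Equiv.refl X)) (fun x => ?_) fun x _ => rfl
      simp only [mem_typeClass]
      rw [show (Equiv.arrowCongr π.symm (Equiv.refl X)) x = x ∘ π from rfl,
        symbolCount_comp_perm]
    rw [Finset.sum_congr rfl fun π _ => h π, Finset.sum_const, Finset.card_univ, nsmul_eq_mul, ← hN,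
      mul_inv_cancel_left₀ hN0.ne']

theorem sum_typeClass_of_perm_invariant {n : ℕ} {P : (Fin n → X) → ℝ}
    (hP : ∀ (π : Equiv.Perm (Fin n)) x, P (x ∘ π) = P x) {x₀ x : Fin n → X}
    (hx : x ∈ typeClass x₀) : ∑ y ∈ typeClass x₀, P y = (typeClass x₀).card * P x := by
  rw [← nsmul_eq_mul, ← Finset.sum_const]
  refine Finset.sum_congr rfl fun y hy => ?_
  obtain ⟨π, rfl⟩ := exists_perm_of_symbolCount_eq
    ((mem_typeClass.1 hx).trans (mem_typeClass.1 hy).symm)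
  exact hP π x

theorem card_typeClass_pos {n : ℕ} (x₀ : Fin n → X) : 0 < (typeClass x₀).card :=
  Finset.card_pos.2 ⟨x₀, mem_typeClass.2 rfl⟩

/-- A large overlap of mixtures of null and alternative distributions singles out a type class, of
non-negligible probability for the null hypothesis, a non-negligible fraction of which is charged
almost uniformly by an alternative distribution. -/
theorem exists_subset_typeClass {n : ℕ} {R S : Set ((Fin n → X) → ℝ)}
    (hR : R ⊆ ProbDist (Fin n → X)) (hS : S ⊆ ProbDist (Fin n → X))
    (hsymm : (∀ P ∈ R, ∀ π : Equiv.Perm (Fin n), ∀ x, P (x ∘ π) = P x) ∨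
      ∀ Q ∈ S, ∀ π : Equiv.Perm (Fin n), (fun x => Q (x ∘ π)) ∈ S)
    {P Q : (Fin n → X) → ℝ} (hP : P ∈ convexHull ℝ R) (hQ : Q ∈ convexHull ℝ S)
    {κ ε : ℝ} (hε0 : 0 < ε) (hε1 : ε < 1)
    (h : ε < ∑ x, min (P x) (κ * Q x)) :
    ∃ x₀ : Fin n → X, ∃ Q' ∈ convexHull ℝ S, ∃ G ⊆ typeClass x₀,
      ε / (n + 1 : ℝ) ^ Fintype.card X ≤ ∑ x ∈ typeClass x₀, P x ∧
      (typeClass x₀).card * (ε / (n + 1 : ℝ) ^ Fintype.card X / 2) ≤ (G.card : ℝ) ∧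
      ∀ x ∈ G, ε / (n + 1 : ℝ) ^ Fintype.card X / (2 * (typeClass x₀).card) ≤ κ * Q' x := by
  classical
  have hP' := convexHull_subset_probDist hR hP
  have hQ' := convexHull_subset_probDist hS hQ
  obtain ⟨x₀, hx₀⟩ := exists_typeClass_sum_ge _ hε0 h.le
  set c := ε / (n + 1 : ℝ) ^ Fintype.card X with hc
  have hpow : (1 : ℝ) ≤ (n + 1 : ℝ) ^ Fintype.card X :=
    one_le_pow₀ (by linarith [n.cast_nonneg (α := ℝ)])
  have hc0 : 0 < c := by positivity
  have hc1 : c ≤ 1 := (div_le_self hε0.le hpow).trans hε1.le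
  have hT : (0 : ℝ) < (typeClass x₀).card := by exact_mod_cast card_typeClass_pos x₀
  have hPc : c ≤ ∑ x ∈ typeClass x₀, P x :=
    hx₀.trans (Finset.sum_le_sum fun x _ => min_le_left _ _)
  rcases hsymm with hR' | hS'
  · -- `P` is uniform on the type class; keep the strings where the overlap is not too small.
    have hinv := perm_invariant_of_mem_convexHull hR' hP
    have hPle : ∀ x ∈ typeClass x₀, P x ≤ 1 / (typeClass x₀).card := by
      intro x hx
      rw [le_div_iff₀ hT, mul_comm, ← sum_typeClass_of_perm_invariant hinv hx, ← hP'.2]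
      exact Finset.sum_le_sum_of_subset_of_nonneg (Finset.subset_univ _) fun x _ _ => hP'.1 x
    refine ⟨x₀, Q, hQ, (typeClass x₀).filter fun x =>
      c / (2 * (typeClass x₀).card) ≤ min (P x) (κ * Q x), Finset.filter_subset _ _, hPc, ?_,
      fun x hx => (Finset.mem_filter.1 hx).2.trans (min_le_right _ _)⟩
    have h1 : ∑ x ∈ typeClass x₀, min (P x) (κ * Q x) ≤
        ∑ x ∈ typeClass x₀, ((if c / (2 * (typeClass x₀).card) ≤ min (P x) (κ * Q x) then
          1 / ((typeClass x₀).card : ℝ) else 0) + c / (2 * (typeClass x₀).card)) := by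
      refine Finset.sum_le_sum fun x hx => ?_
      have h2 : 0 ≤ c / (2 * (typeClass x₀).card) := by positivity
      split_ifs with h3
      · linarith [hPle x hx, min_le_left (P x) (κ * Q x)]
      · linarith
    rw [Finset.sum_add_distrib, ← Finset.sum_filter, Finset.sum_const, Finset.sum_const,
      nsmul_eq_mul, nsmul_eq_mul] at h1
    have h2 : ((typeClass x₀).card : ℝ) * (c / (2 * (typeClass x₀).card)) = c / 2 := by
      field_simp
    rw [h2, mul_one_div] at h1
    have h3 := hx₀.trans h1
    rw [← sub_le_iff_le_add, le_div_iff₀ hT] at h3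
    linarith
  · -- Symmetrise the alternative and keep the whole type class.
    obtain ⟨Q', hQS, hinv, hsum⟩ := exists_symmetrization hS' hQ
    refine ⟨x₀, Q', hQS, typeClass x₀, subset_rfl, hPc, ?_, fun x hx => ?_⟩
    · nlinarith
    · have h1 : c ≤ κ * ∑ x ∈ typeClass x₀, Q x := by
        rw [Finset.mul_sum]
        exact hx₀.trans (Finset.sum_le_sum fun x _ => min_le_right _ _)
      rw [← hsum, sum_typeClass_of_perm_invariant hinv hx] at h1
      rw [div_le_iff₀ (by positivity)]
      nlinarith

/-- Hamming distance of a string from a nonempty set of strings. -/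
noncomputable def distToSet [DecidableEq X] {n : ℕ} (G : Finset (Fin n → X)) (hG : G.Nonempty)
    (y : Fin n → X) : ℝ :=
  G.inf' hG fun x => (hammingDist x y : ℝ)

/-- Blowing-up: the expected distance from a set that is not exponentially small for the i.i.d.
distribution `T` is sublinear, up to the error made in replacing `T` by `P`. -/
theorem sum_tensorPow_mul_distToSet_le [DecidableEq X] {P T : X → ℝ} (hP : P ∈ ProbDist X)
    (hT : T ∈ ProbDist X) {n : ℕ} {G : Finset (Fin n → X)} (hG : G.Nonempty) {τ : ℝ} (hτ : 0 < τ)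
    (h : τ ≤ ∑ x ∈ G, tensorPow T n x) {t : ℝ} (ht0 : 0 < t) (ht1 : t ≤ 1) :
    ∑ x, tensorPow P n x * distToSet G hG x ≤
      -Real.log τ / t + n * ∑ a, |P a - T a| + n * t := by
  have hlip : ∀ x y, distToSet G hG x - distToSet G hG y ≤ hammingDist x y := by
    intro x y
    obtain ⟨z, hz, hzy⟩ := Finset.exists_mem_eq_inf' hG fun x => (hammingDist x y : ℝ)
    have h1 : distToSet G hG x ≤ hammingDist z x := Finset.inf'_le _ hz
    have h2 : distToSet G hG y = hammingDist z y := hzy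
    have h3 : (hammingDist z x : ℝ) ≤ hammingDist z y + hammingDist x y := by
      have := hammingDist_triangle z y x
      rw [hammingDist_comm y x] at this
      exact_mod_cast this
    linarith
  have h0 : ∀ x ∈ G, distToSet G hG x ≤ 0 := fun x hx => by
    have : distToSet G hG x ≤ hammingDist x x := Finset.inf'_le _ hx
    simpa using this
  have h1 := sum_tensorPow_mul_exp_neg_le hP hT ht0.le ht1 _ hlip
  have h2 : τ ≤ ∑ x, tensorPow T n x * Real.exp (-t * distToSet G hG x) := by
    refine h.trans ?_
    calc ∑ x ∈ G, tensorPow T n x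
        ≤ ∑ x ∈ G, tensorPow T n x * Real.exp (-t * distToSet G hG x) := by
          refine Finset.sum_le_sum fun x hx => le_mul_of_one_le_right (tensorPow_nonneg hT x) ?_
          exact Real.one_le_exp (by nlinarith [h0 x hx])
      _ ≤ _ := Finset.sum_le_sum_of_subset_of_nonneg (Finset.subset_univ _)
          fun x _ _ => mul_nonneg (tensorPow_nonneg hT x) (Real.exp_pos _).le
  have h3 := (Real.log_le_iff_le_exp hτ).2 (h2.trans h1)
  set E := ∑ x, tensorPow P n x * distToSet G hG x
  have h4 : E ≤ (-Real.log τ + n * (t * ∑ a, |P a - T a| + t ^ 2)) / t := by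
    rw [le_div_iff₀ ht0]
    linarith
  refine h4.trans (le_of_eq ?_)
  field_simp
  ring

/-- The noisy version of `Q` at `y` is at least the contribution of any string `x`: mixing keeps a
symbol with weight at least `1 - δ` and turns it into any other symbol `y i` with weight at least
`δ * r`. -/
theorem le_channelPow_depol [DecidableEq X] {R₀ : X → ℝ} (hR₀ : R₀ ∈ ProbDist X) {r δ : ℝ}
    (hr0 : 0 < r) (hδ0 : 0 < δ) (hδ1 : δ < 1) {n : ℕ} {Q : (Fin n → X) → ℝ} (hQ : ∀ x, 0 ≤ Q x)
    (x y : Fin n → X) (hy : ∀ i, r ≤ R₀ (y i)) :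
    Q x * ((1 - δ) ^ n * (δ * r) ^ hammingDist x y) ≤ channelPow (depol δ R₀) n Q y := by
  have hnn : ∀ a b, 0 ≤ depol δ R₀ a b := by
    intro a b
    have := hR₀.1 b
    have h1 : 0 ≤ 1 - δ := by linarith
    rw [depol]
    split_ifs <;> simp <;> positivity
  refine le_trans ?_ (Finset.single_le_sum (f := fun x => Q x * ∏ i, depol δ R₀ (x i) (y i))
    (fun x _ => mul_nonneg (hQ x) (Finset.prod_nonneg fun i _ => hnn _ _)) (Finset.mem_univ x))
  refine mul_le_mul_of_nonneg_left ?_ (hQ x)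
  have h1 : (1 - δ) ^ n * (δ * r) ^ hammingDist x y =
      ∏ i, ((1 - δ) * if x i ≠ y i then δ * r else 1) := by
    rw [Finset.prod_mul_distrib, Finset.prod_const, Finset.card_univ, Fintype.card_fin,
      Finset.prod_ite, Finset.prod_const_one, mul_one, Finset.prod_const]
    rfl
  rw [h1]
  have h1δ : 0 < 1 - δ := by linarith
  refine Finset.prod_le_prod (fun i _ => by positivity) fun i _ => ?_
  have h2 := mul_le_mul_of_nonneg_left (hy i) hδ0.le
  have h3 : 0 < δ * r := mul_pos hδ0 hr0
  by_cases hi : x i = y i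
  · simp only [hi, ne_eq, not_true_eq_false, if_false, depol, if_true]
    linarith
  · simp only [hi, ne_eq, not_false_eq_true, if_true, depol, if_false]
    nlinarith

/-- If `Q` charges a large part `G` of a type class almost uniformly, then symbol-wise mixing with a
noise that charges the support of `P` turns it into a distribution whose relative entropy from an i.i.d. distribution
with marginal close to the type is small. -/
theorem relEntropy_channelPow_depol_le {P R₀ : X → ℝ} (hP : P ∈ ProbDist X)
    (hR₀ : R₀ ∈ ProbDist X) {r : ℝ} (hr0 : 0 < r) (hr1 : r ≤ 1) (hr : ∀ a, 0 < P a → r ≤ R₀ a)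
    {n : ℕ} (hn : 1 ≤ n) (x₀ : Fin n → X) {G : Finset (Fin n → X)} (hG : G ⊆ typeClass x₀)
    {Q : (Fin n → X) → ℝ} (hQ : ∀ x, 0 ≤ Q x) {κ c : ℝ} (hκ : 0 < κ) (hc : 0 < c)
    (hGcard : (typeClass x₀).card * (c / 2) ≤ (G.card : ℝ))
    (hGQ : ∀ x ∈ G, c / (2 * (typeClass x₀).card) ≤ κ * Q x)
    {δ : ℝ} (hδ0 : 0 < δ) (hδ1 : δ < 1) {t : ℝ} (ht0 : 0 < t) (ht1 : t ≤ 1) :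
    relEntropy (tensorPow P n) (channelPow (depol δ R₀) n Q) ≤
      ((Real.log (2 * κ / c) + n * (entropy (stringType x₀) - entropy P) - n * Real.log (1 - δ)
        - Real.log (δ * r) * (Real.log (2 * (n + 1 : ℝ) ^ Fintype.card X / c) / t
          + n * ∑ a, |P a - stringType x₀ a| + n * t) : ℝ) : EReal) := by
  classical
  set T := stringType x₀ with hTdef
  have hTmem : T ∈ ProbDist X := stringType_mem hn x₀
  have hcard : (0 : ℝ) < (typeClass x₀).card := by exact_mod_cast card_typeClass_pos x₀
  have hGne : G.Nonempty := by
    rw [← Finset.card_pos]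
    have : (0 : ℝ) < G.card := lt_of_lt_of_le (by positivity) hGcard
    exact_mod_cast this
  have hclass : ∑ x ∈ typeClass x₀, tensorPow T n x =
      (typeClass x₀).card * Real.exp (-(n * entropy T)) := by
    rw [← nsmul_eq_mul, ← Finset.sum_const]
    exact Finset.sum_congr rfl fun x hx => tensorPow_stringType hx
  have hGsum : ∑ x ∈ G, tensorPow T n x = G.card * Real.exp (-(n * entropy T)) := by
    rw [← nsmul_eq_mul, ← Finset.sum_const]
    exact Finset.sum_congr rfl fun x hx => tensorPow_stringType (hG hx)
  have hlogcard : Real.log (typeClass x₀).card ≤ n * entropy T := by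
    rw [Real.log_le_iff_le_exp hcard]
    have h1 : ∑ x ∈ typeClass x₀, tensorPow T n x ≤ 1 := by
      rw [← (tensorPow_mem hTmem n).2]
      exact Finset.sum_le_sum_of_subset_of_nonneg (Finset.subset_univ _)
        fun x _ _ => tensorPow_nonneg hTmem x
    rw [hclass, Real.exp_neg, ← div_eq_mul_inv, div_le_one (Real.exp_pos _)] at h1
    exact h1
  have hpow : (0 : ℝ) < (n + 1 : ℝ) ^ Fintype.card X := by positivity
  have hτ : c / (2 * (n + 1 : ℝ) ^ Fintype.card X) ≤ ∑ x ∈ G, tensorPow T n x := by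
    have h1 := le_sum_tensorPow_stringType hn x₀
    rw [← hTdef, hclass] at h1
    rw [hGsum]
    calc c / (2 * (n + 1 : ℝ) ^ Fintype.card X) =
          c / 2 * (1 / (n + 1 : ℝ) ^ Fintype.card X) := by field_simp
      _ ≤ c / 2 * ((typeClass x₀).card * Real.exp (-(n * entropy T))) :=
          mul_le_mul_of_nonneg_left h1 (by positivity)
      _ = (typeClass x₀).card * (c / 2) * Real.exp (-(n * entropy T)) := by ring
      _ ≤ _ := mul_le_mul_of_nonneg_right hGcard (Real.exp_pos _).le
  have hE := sum_tensorPow_mul_distToSet_le hP hTmem hGne (by positivity) hτ ht0 ht1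
  have hlogτ : -Real.log (c / (2 * (n + 1 : ℝ) ^ Fintype.card X)) =
      Real.log (2 * (n + 1 : ℝ) ^ Fintype.card X / c) := by
    rw [← Real.log_inv, inv_div]
  rw [hlogτ] at hE
  have hδr : 0 < δ * r := mul_pos hδ0 hr0
  have hL : 0 ≤ -Real.log (δ * r) :=
    neg_nonneg.2 (Real.log_nonpos hδr.le (by nlinarith))
  have h1δ : 0 < 1 - δ := by linarith
  set C₀ := Real.log (2 * κ / c) + n * entropy T - n * Real.log (1 - δ) with hC₀
  have hsupp : ∀ y : Fin n → X, 0 < tensorPow P n y → ∀ i, 0 < P (y i) := by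
    intro y hy i
    refine lt_of_le_of_ne (hP.1 _) fun h0 => hy.ne' ?_
    exact Finset.prod_eq_zero (Finset.mem_univ i) h0.symm
  have hlow : ∀ y : Fin n → X, 0 < tensorPow P n y →
      0 < channelPow (depol δ R₀) n Q y ∧
        -Real.log (channelPow (depol δ R₀) n Q y) ≤
          C₀ - Real.log (δ * r) * distToSet G hGne y := by
    intro y hy
    obtain ⟨z, hz, hzy⟩ := Finset.exists_mem_eq_inf' hGne fun x => (hammingDist x y : ℝ)
    have hzy' : distToSet G hGne y = hammingDist z y := hzy
    have h1 := le_channelPow_depol hR₀ hr0 hδ0 hδ1 hQ z y fun i => hr _ (hsupp y hy i)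
    have h2 : c / (2 * κ * (typeClass x₀).card) ≤ Q z := by
      have := hGQ z hz
      rw [div_le_iff₀ (by positivity)] at this ⊢
      linarith
    have h3 : c / (2 * κ * (typeClass x₀).card) * ((1 - δ) ^ n * (δ * r) ^ hammingDist z y) ≤
        channelPow (depol δ R₀) n Q y :=
      (mul_le_mul_of_nonneg_right h2 (by positivity)).trans h1
    have h4 : 0 < c / (2 * κ * (typeClass x₀).card) *
        ((1 - δ) ^ n * (δ * r) ^ hammingDist z y) := by positivity
    refine ⟨h4.trans_le h3, ?_⟩
    have h5 := Real.log_le_log h4 h3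
    rw [Real.log_mul (by positivity) (by positivity), Real.log_mul (by positivity) (by positivity),
      Real.log_pow, Real.log_pow, Real.log_div hc.ne' (by positivity),
      Real.log_mul (by positivity) hcard.ne'] at h5
    rw [hzy', hC₀, Real.log_div (by positivity) hc.ne']
    linarith
  rw [relEntropy, if_pos, EReal.coe_le_coe_iff]
  swap
  · intro y hy
    by_contra h0
    have := (hlow y (lt_of_le_of_ne (tensorPow_nonneg hP y) (Ne.symm h0))).1
    exact this.ne' hy
  have hterm : ∀ y : Fin n → X,
      tensorPow P n y * Real.log (tensorPow P n y / channelPow (depol δ R₀) n Q y) ≤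
        tensorPow P n y * ∑ i, Real.log (P (y i)) + C₀ * tensorPow P n y
          - Real.log (δ * r) * (tensorPow P n y * distToSet G hGne y) := by
    intro y
    rcases (tensorPow_nonneg hP y).eq_or_lt with h0 | h0
    · simp [← h0]
    · obtain ⟨h1, h2⟩ := hlow y h0
      have h3 : Real.log (tensorPow P n y) = ∑ i, Real.log (P (y i)) :=
        Real.log_prod fun i _ => (hsupp y h0 i).ne'
      rw [Real.log_div h0.ne' h1.ne', h3]
      have := mul_le_mul_of_nonneg_left h2 h0.le
      linarith
  refine (Finset.sum_le_sum fun y _ => hterm y).trans ?_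
  rw [Finset.sum_sub_distrib, Finset.sum_add_distrib, ← Finset.mul_sum, ← Finset.mul_sum,
    (tensorPow_mem hP n).2, sum_tensorPow_mul_sum hP fun a => Real.log (P a)]
  have hent : ∑ a, P a * Real.log (P a) = -entropy P := by
    rw [entropy, ← Finset.sum_neg_distrib]
    exact Finset.sum_congr rfl fun a _ => by rw [Real.negMulLog]; ring
  rw [hent]
  have := mul_le_mul_of_nonneg_left hE hL
  linarith

end Blurring

/-! ### Stein exponent -/

section SteinExponent

variable {X : Type*} [Fintype X]

theorem pos_of_mem_convexHull {Z : Type*} {S : Set (Z → ℝ)} {z : Z} {p : Prop}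
    (hS : ∀ Q ∈ S, 0 < Q z → p) {Q : Z → ℝ} (hQ : Q ∈ convexHull ℝ S) (hz : 0 < Q z) : p := by
  by_contra hp
  have h : convexHull ℝ S ⊆ {Q | Q z ≤ 0} := by
    refine convexHull_min (fun Q hQ => not_lt.1 fun h => hp (hS Q hQ h)) ?_
    exact convex_halfSpace_le (LinearMap.proj (R := ℝ) (φ := fun _ : Z => ℝ) z).isLinear 0
  exact (h hQ).not_gt hz

theorem channelPow_mem_convexHull {W : Matrix X X ℝ} {n : ℕ} {S : Set ((Fin n → X) → ℝ)}
    (hS : ∀ Q ∈ S, channelPow W n Q ∈ S) {Q : (Fin n → X) → ℝ} (hQ : Q ∈ convexHull ℝ S) :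
    channelPow W n Q ∈ convexHull ℝ S := by
  have hlin : IsLinearMap ℝ (channelPow W n) :=
    ⟨fun P Q => by funext y; simp [channelPow, add_mul, Finset.sum_add_distrib],
      fun c Q => by funext y; simp [channelPow, mul_assoc, Finset.mul_sum]⟩
  have h : convexHull ℝ S ⊆ channelPow W n ⁻¹' convexHull ℝ S :=
    convexHull_min (fun Q hQ => subset_convexHull ℝ S (hS Q hQ))
      ((convex_convexHull ℝ S).is_linear_preimage hlin)
  exact h hQ

theorem lt_of_mul_neg_log_lt {β : ENNReal} {n : ℕ} (hn : 1 ≤ n) {c : ℝ}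
    (h : ((1 / (n : ℝ) : ℝ) : EReal) * -β.log < c) :
    ENNReal.ofReal (Real.exp (-(c * n))) < β := by
  by_contra! hle
  have hn0 : (0 : ℝ) < n := by exact_mod_cast hn
  have h1 := ENNReal.log_monotone hle
  rw [ENNReal.log_ofReal_of_pos (Real.exp_pos _), Real.log_exp] at h1
  have h2 : ((c * n : ℝ) : EReal) ≤ -β.log := by
    rw [EReal.le_neg]
    simpa using h1
  have h3 := mul_le_mul_of_nonneg_left h2
    (a := ((1 / (n : ℝ) : ℝ) : EReal)) (by exact_mod_cast (one_div_pos.2 hn0).le)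
  rw [← EReal.coe_mul, show 1 / (n : ℝ) * (c * n) = c by field_simp] at h3
  exact h3.not_gt h

/-- A type II error decaying more slowly than `exp (-c n)` produces a type that is not too unlikely
under the null hypothesis, and alternatives that are close to every i.i.d. distribution whose
marginal is close to that type. -/
theorem exists_string_of_lt_minTypeII {R S : Family X} (hR : IsHypothesis R)
    (hS : IsHypothesis S) (hsymm : PermSymmetric R ∨ ClosedUnderPerms S)
    {R₀ : X → ℝ} (hR₀ : R₀ ∈ ProbDist X)
    (hmix : ∀ n : ℕ, 1 ≤ n → ∀ Q ∈ S n, (∀ x, 0 < Q x → ∀ i, 0 < R₀ (x i)) ∧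
      ∀ δ ∈ Set.Icc (0 : ℝ) 1, channelPow (depol δ R₀) n Q ∈ S n)
    {r : ℝ} (hr0 : 0 < r) (hr1 : r ≤ 1) (hr : ∀ a, 0 < R₀ a → r ≤ R₀ a)
    {ε : ℝ} (hε0 : 0 < ε) (hε1 : ε < 1) {n : ℕ} (hn : 1 ≤ n) {c : ℝ}
    (h : ENNReal.ofReal (Real.exp (-(c * n))) < minTypeII ε (R n) (S n)) :
    ∃ x₀ : Fin n → X,
      (∃ P ∈ convexHull ℝ (R n),
        ε / (n + 1 : ℝ) ^ Fintype.card X ≤ ∑ x ∈ typeClass x₀, P x) ∧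
      (∀ a, 0 < stringType x₀ a → 0 < R₀ a) ∧
      ∀ P ∈ ProbDist X, (∀ a, 0 < P a → 0 < R₀ a) → ∀ δ, 0 < δ → δ < 1 → ∀ t, 0 < t → t ≤ 1 →
        ((1 / (n : ℝ) : ℝ) : EReal) * ⨅ Q ∈ convexHull ℝ (S n), relEntropy (tensorPow P n) Q ≤
          ((c + (Real.log 2 * (1 / n) + Fintype.card X * (Real.log (n + 1) / n))
            + (entropy (stringType x₀) - entropy P) - Real.log (1 - δ)
            - Real.log (δ * r) * (((Real.log 2 - Real.log ε) * (1 / n)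
              + 2 * Fintype.card X * (Real.log (n + 1) / n)) / t
              + ∑ a, |P a - stringType x₀ a| + t) : ℝ) : EReal) := by
  classical
  have hn0 : (0 : ℝ) < n := by exact_mod_cast hn
  obtain ⟨P', hP', Q', hQ', hlt⟩ :=
    exists_sum_min_gt (hR n hn) (hS n hn) hε0 (Real.exp_pos _) h
  set κ := ε / Real.exp (-(c * n)) with hκ
  have hκ0 : 0 < κ := by positivity
  obtain ⟨x₀, Q, hQ, G, hG, hPc, hGcard, hGQ⟩ := exists_subset_typeClass (hR n hn) (hS n hn)
    (hsymm.imp (fun h => h n hn) fun h => h n hn) hP' hQ' hε0 hε1 hlt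
  have hpow : (0 : ℝ) < (n + 1 : ℝ) ^ Fintype.card X := by positivity
  have hcard : (0 : ℝ) < (typeClass x₀).card := by exact_mod_cast card_typeClass_pos x₀
  refine ⟨x₀, ⟨P', hP', hPc⟩, ?_, ?_⟩
  · intro a ha
    have hGne : G.Nonempty := by
      rw [← Finset.card_pos]
      have : (0 : ℝ) < G.card := lt_of_lt_of_le (by positivity) hGcard
      exact_mod_cast this
    obtain ⟨x, hx⟩ := hGne
    have hQx : 0 < Q x :=
      pos_of_mul_pos_right (lt_of_lt_of_le (by positivity) (hGQ x hx)) hκ0.le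
    have hsupp := pos_of_mem_convexHull (fun Q hQ => (hmix n hn Q hQ).1 x) hQ hQx
    rw [stringType_eq, ← mem_typeClass.1 (hG hx)] at ha
    have hcount : 0 < symbolCount x a := by
      rcases Nat.eq_zero_or_pos (symbolCount x a) with h0 | h0
      · simp [h0] at ha
      · exact h0
    obtain ⟨i, hi⟩ := Finset.card_pos.1 hcount
    rw [← (Finset.mem_filter.1 hi).2]
    exact hsupp i
  · intro P hP hPR δ hδ0 hδ1 t ht0 ht1
    have hbound := relEntropy_channelPow_depol_le hP hR₀ hr0 hr1 (fun a ha => hr a (hPR a ha)) hn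
      x₀ hG (convexHull_subset_probDist (hS n hn) hQ).1 hκ0 (by positivity) hGcard hGQ hδ0 hδ1
      ht0 ht1
    have hmem := channelPow_mem_convexHull (fun Q hQ => (hmix n hn Q hQ).2 δ ⟨hδ0.le, hδ1.le⟩) hQ
    have h1 := (iInf₂_le (f := fun Q (_ : Q ∈ convexHull ℝ (S n)) =>
      relEntropy (tensorPow P n) Q) _ hmem).trans hbound
    have h2 := mul_le_mul_of_nonneg_left h1
      (a := ((1 / (n : ℝ) : ℝ) : EReal)) (by exact_mod_cast (one_div_pos.2 hn0).le)
    rw [← EReal.coe_mul] at h2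
    refine h2.trans (EReal.coe_le_coe_iff.2 (le_of_eq ?_))
    have hl1 : Real.log (2 * κ / (ε / (n + 1 : ℝ) ^ Fintype.card X)) =
        Real.log 2 + c * n + Fintype.card X * Real.log (n + 1) := by
      rw [hκ, Real.exp_neg, show 2 * (ε / (Real.exp (c * n))⁻¹) / (ε / (n + 1 : ℝ) ^ Fintype.card X)
        = 2 * Real.exp (c * n) * (n + 1 : ℝ) ^ Fintype.card X by field_simp,
        Real.log_mul (by positivity) hpow.ne', Real.log_mul two_ne_zero (Real.exp_pos _).ne',
        Real.log_exp, Real.log_pow]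
    have hl2 : Real.log (2 * (n + 1 : ℝ) ^ Fintype.card X / (ε / (n + 1 : ℝ) ^ Fintype.card X)) =
        Real.log 2 - Real.log ε + 2 * Fintype.card X * Real.log (n + 1) := by
      rw [show 2 * (n + 1 : ℝ) ^ Fintype.card X / (ε / (n + 1 : ℝ) ^ Fintype.card X) =
        2 * ((n + 1 : ℝ) ^ Fintype.card X * (n + 1 : ℝ) ^ Fintype.card X) / ε by field_simp,
        Real.log_div (by positivity) hε0.ne', Real.log_mul two_ne_zero (by positivity),
        Real.log_mul hpow.ne' hpow.ne', Real.log_pow]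
      ring
    rw [hl1, hl2]
    field_simp
    ring

theorem tendsto_log_add_one_div : Tendsto (fun n : ℕ => Real.log (n + 1) / n) atTop (𝓝 0) := by
  have h := (Real.tendsto_pow_log_div_mul_add_atTop 1 (-1) 1 one_ne_zero).comp
    (tendsto_natCast_atTop_atTop.comp (tendsto_add_atTop_nat 1))
  refine h.congr fun n => ?_
  simp

theorem continuous_entropy : Continuous (entropy : (X → ℝ) → ℝ) :=
  continuous_finsetSum _ fun a _ => Real.continuous_negMulLog.comp (continuous_apply a)

theorem sum_le_probTypeNear {n : ℕ} {Q : (Fin n → X) → ℝ} (hQ : ∀ x, 0 ≤ Q x) {P : X → ℝ} {δ : ℝ}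
    {x₀ : Fin n → X} (h : tvDist (stringType x₀) P ≤ δ) :
    ∑ x ∈ typeClass x₀, Q x ≤ probTypeNear Q P δ := by
  classical
  refine Finset.sum_le_sum_of_subset_of_nonneg (fun x hx => ?_) fun x _ _ => hQ x
  have h1 : stringType x = stringType x₀ := by
    funext a
    rw [stringType_eq, stringType_eq, mem_typeClass.1 hx]
  simpa [h1] using h

/-- A limit of types having, along a subsequence, inverse polynomial probability under mixtures of
members of a type-stable family belongs to the one-letter set. -/
theorem mem_base_of_tendsto {R : Family X} (hR : IsHypothesis R) (hstable : TypeStable R)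
    {P : X → ℝ} (hP : P ∈ ProbDist X) {ε : ℝ} (hε : 0 < ε) {θ : ℕ → ℕ} (hθ : Tendsto θ atTop atTop)
    (x₀ : ∀ k, Fin (θ k) → X) (hlim : Tendsto (fun k => stringType (x₀ k)) atTop (𝓝 P))
    (hmass : ∀ k, ∃ P' ∈ convexHull ℝ (R (θ k)),
      ε / ((θ k : ℝ) + 1) ^ Fintype.card X ≤ ∑ x ∈ typeClass (x₀ k), P' x) : P ∈ R.base := by
  classical
  refine hstable P hP ⟨(Fintype.card X + 1 : ℕ), by positivity, fun δ hδ => ?_⟩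
  refine hθ.frequently (Eventually.frequently ?_)
  have htv : Tendsto (fun k => tvDist (stringType (x₀ k)) P) atTop (𝓝 0) := by
    have hcont : Continuous fun T : X → ℝ => tvDist T P := by
      unfold tvDist; fun_prop
    have := (hcont.tendsto P).comp hlim
    simpa [tvDist, Function.comp_def] using this
  have hlarge : ∀ᶠ k in atTop, (2 : ℝ) ^ Fintype.card X / ε < θ k :=
    (tendsto_natCast_atTop_atTop.comp hθ).eventually (eventually_gt_atTop _)
  filter_upwards [htv.eventually (ge_mem_nhds hδ), hlarge, hθ.eventually (eventually_ge_atTop 1)]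
    with k hk hk2 hk1
  by_contra! hcon
  obtain ⟨P', hP', hm⟩ := hmass k
  have hn1 : (1 : ℝ) ≤ θ k := by exact_mod_cast hk1
  have hn0 : (0 : ℝ) < θ k := by linarith
  rw [Real.rpow_natCast] at hcon
  have h1 : ∀ Q ∈ R (θ k), ∑ x, (if x ∈ typeClass (x₀ k) then 1 else 0) * Q x ≤
      1 / (θ k : ℝ) ^ (Fintype.card X + 1) := by
    intro Q hQ
    have h2 : ENNReal.ofReal (probTypeNear Q P δ) ≤
        ENNReal.ofReal (1 / (θ k : ℝ) ^ (Fintype.card X + 1)) :=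
      (le_iSup₂ (f := fun Q (_ : Q ∈ R (θ k)) => ENNReal.ofReal (probTypeNear Q P δ)) Q hQ).trans
        hcon.le
    rw [ENNReal.ofReal_le_ofReal_iff (by positivity)] at h2
    simpa using (sum_le_probTypeNear (hR _ hk1 hQ).1 hk).trans h2
  have h2 := sum_mul_le_of_mem_convexHull h1 hP'
  simp only [ite_mul, one_mul, zero_mul, Finset.sum_ite_mem, Finset.univ_inter] at h2
  have h3 := hm.trans h2
  rw [div_le_div_iff₀ (by positivity) (by positivity), one_mul] at h3
  have h4 : ((θ k : ℝ) + 1) ^ Fintype.card X ≤ 2 ^ Fintype.card X * (θ k : ℝ) ^ Fintype.card X := by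
    rw [← mul_pow]
    exact pow_le_pow_left₀ (by positivity) (by linarith) _
  rw [div_lt_iff₀ hε] at hk2
  have h5 : (0 : ℝ) < (θ k : ℝ) ^ Fintype.card X := by positivity
  rw [pow_succ] at h3
  nlinarith

/-- Achievability: the regularised relative entropy is an attainable type II error exponent for
every threshold on the type I error. -/
theorem le_liminf_minTypeII {R S : Family X} (hR : IsHypothesis R) (hS : IsHypothesis S)
    (hstable : TypeStable R) (hmix : ClosedUnderMixing S)
    (hsymm : PermSymmetric R ∨ ClosedUnderPerms S) {ε : ℝ} (hε0 : 0 < ε) (hε1 : ε < 1) :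
    (⨅ P ∈ R.base, liminf (fun n : ℕ => ((1 / (n : ℝ) : ℝ) : EReal) *
      ⨅ Q ∈ convexHull ℝ (S n), relEntropy (tensorPow P n) Q) atTop) ≤
    liminf (fun n : ℕ => ((1 / (n : ℝ) : ℝ) : EReal) * -(minTypeII ε (R n) (S n)).log) atTop := by
  by_contra! hcon
  obtain ⟨c, hc, hc'⟩ := EReal.lt_iff_exists_real_btwn.1 hcon
  obtain ⟨c', hcc', hc'⟩ := EReal.lt_iff_exists_real_btwn.1 hc'
  have hη : 0 < c' - c := sub_pos.2 (EReal.coe_lt_coe_iff.1 hcc')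
  obtain ⟨R₀, hR₀, hmix⟩ := hmix
  obtain ⟨r, hr0, hr1, hr⟩ : ∃ r : ℝ, 0 < r ∧ r ≤ 1 ∧ ∀ a, 0 < R₀ a → r ≤ R₀ a := by
    have hfin : ∀ s : Finset X, ∃ r : ℝ, 0 < r ∧ r ≤ 1 ∧ ∀ a ∈ s, 0 < R₀ a → r ≤ R₀ a := by
      classical
      intro s
      induction s using Finset.induction_on with
      | empty => exact ⟨1, one_pos, le_rfl, by simp⟩
      | insert b s _ ih =>
        obtain ⟨r, hr0, hr1, hr⟩ := ih
        by_cases hb : 0 < R₀ b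
        · refine ⟨min r (R₀ b), lt_min hr0 hb, (min_le_left _ _).trans hr1, fun a ha h => ?_⟩
          rcases Finset.mem_insert.1 ha with rfl | ha
          · exact min_le_right _ _
          · exact (min_le_left _ _).trans (hr a ha h)
        · refine ⟨r, hr0, hr1, fun a ha h => ?_⟩
          rcases Finset.mem_insert.1 ha with rfl | ha
          · exact absurd h hb
          · exact hr a ha h
    obtain ⟨r, hr0, hr1, hr⟩ := hfin Finset.univ
    exact ⟨r, hr0, hr1, fun a => hr a (Finset.mem_univ a)⟩
  obtain ⟨φ, hφ, hgood⟩ := extraction_of_frequently_atTop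
    ((frequently_lt_of_liminf_lt (by isBoundedDefault) hc).and_eventually (eventually_ge_atTop 1))
  choose x₀ hmass hsupp hbound using fun k => exists_string_of_lt_minTypeII hR hS hsymm hR₀ hmix
    hr0 hr1 hr hε0 hε1 (hgood k).2 (lt_of_mul_neg_log_lt (hgood k).2 (hgood k).1)
  obtain ⟨P, hP, ψ, hψ, hlim⟩ := (isCompact_stdSimplex ℝ X).tendsto_subseq
    fun k => stringType_mem (hgood k).2 (x₀ k)
  have hθ : Tendsto (φ ∘ ψ) atTop atTop := (hφ.comp hψ).tendsto_atTop
  have hPbase : P ∈ R.base := mem_base_of_tendsto hR hstable hP hε0 hθ (fun k => x₀ (ψ k)) hlim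
    fun k => hmass (ψ k)
  have hPsupp : ∀ a, 0 < P a → 0 < R₀ a := by
    intro a ha
    have h1 : Tendsto (fun k => stringType (x₀ (ψ k)) a) atTop (𝓝 (P a)) :=
      (tendsto_pi_nhds.1 hlim) a
    obtain ⟨k, hk⟩ := (h1.eventually (lt_mem_nhds ha)).exists
    exact hsupp _ a hk
  -- The mixing strength is chosen so that `-log (1 - δ)` is a quarter of the available gap.
  set δ := 1 - Real.exp (-((c' - c) / 4)) with hδ
  have hδ0 : 0 < δ := by
    have : Real.exp (-((c' - c) / 4)) < 1 := Real.exp_lt_one_iff.2 (by linarith)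
    linarith
  have hδ1 : δ < 1 := by
    have := Real.exp_pos (-((c' - c) / 4))
    linarith
  have hlogδ : Real.log (1 - δ) = -((c' - c) / 4) := by
    rw [hδ, sub_sub_cancel, Real.log_exp]
  have hL : Real.log (δ * r) ≤ 0 := Real.log_nonpos (by positivity) (by nlinarith)
  obtain ⟨t, ht0, ht1, htL⟩ : ∃ t : ℝ, 0 < t ∧ t ≤ 1 ∧ -Real.log (δ * r) * t ≤ (c' - c) / 4 := by
    have hL1 : 0 < -Real.log (δ * r) + 1 := by linarith
    refine ⟨min 1 ((c' - c) / 4 / (-Real.log (δ * r) + 1)), by positivity, min_le_left _ _, ?_⟩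
    calc _ ≤ (-Real.log (δ * r) + 1) * ((c' - c) / 4 / (-Real.log (δ * r) + 1)) :=
          mul_le_mul (by linarith) (min_le_right _ _) (by positivity) hL1.le
      _ = (c' - c) / 4 := by field_simp
  have hinv : Tendsto (fun k => 1 / (((φ ∘ ψ) k : ℕ) : ℝ)) atTop (𝓝 0) :=
    tendsto_one_div_atTop_nhds_zero_nat.comp hθ
  have hlog : Tendsto (fun k => Real.log (((φ ∘ ψ) k : ℕ) + 1) / (((φ ∘ ψ) k : ℕ) : ℝ))
      atTop (𝓝 0) := tendsto_log_add_one_div.comp hθ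
  have hent : Tendsto (fun k => entropy (stringType (x₀ (ψ k)))) atTop (𝓝 (entropy P)) :=
    (continuous_entropy.tendsto P).comp hlim
  have hdist : Tendsto (fun k => ∑ a, |P a - stringType (x₀ (ψ k)) a|) atTop (𝓝 0) := by
    have hcont : Continuous fun T : X → ℝ => ∑ a, |P a - T a| := by fun_prop
    have := (hcont.tendsto P).comp hlim
    simpa [Function.comp_def] using this
  have htend := ((((hinv.const_mul (Real.log 2)).add (hlog.const_mul (Fintype.card X : ℝ))).const_add
    c).add (hent.sub_const (entropy P))).sub_const (Real.log (1 - δ)) |>.sub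
    ((((((hinv.const_mul (Real.log 2 - Real.log ε)).add
      (hlog.const_mul (2 * Fintype.card X : ℝ))).div_const t).add hdist).add_const t).const_mul
        (Real.log (δ * r)))
  have hlt : c + (Real.log 2 * 0 + Fintype.card X * 0) + (entropy P - entropy P)
      - Real.log (1 - δ) - Real.log (δ * r) * (((Real.log 2 - Real.log ε) * 0
        + 2 * Fintype.card X * 0) / t + 0 + t) < c' := by
    rw [hlogδ]
    simp only [mul_zero, add_zero, zero_div, zero_add, sub_self]
    linarith
  have hfreq : ∃ᶠ n : ℕ in atTop, ((1 / (n : ℝ) : ℝ) : EReal) *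
      ⨅ Q ∈ convexHull ℝ (S n), relEntropy (tensorPow P n) Q ≤ c' := by
    refine hθ.frequently (Eventually.frequently ?_)
    filter_upwards [htend.eventually (gt_mem_nhds hlt)] with k hk
    exact (hbound (ψ k) P hP hPsupp δ hδ0 hδ1 t ht0 ht1).trans (EReal.coe_le_coe_iff.2 hk.le)
  have h1 := liminf_le_of_frequently_le' hfreq
  exact (hc'.trans_le (iInf₂_le P hPbase)).not_ge h1

theorem regRelEntropy_iidFamily_singleton (P : X → ℝ) (S : Family X) :
    regRelEntropy (iidFamily {P}) S.co = liminf (fun n : ℕ => ((1 / (n : ℝ) : ℝ) : EReal) *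
      ⨅ Q ∈ convexHull ℝ (S n), relEntropy (tensorPow P n) Q) atTop := by
  simp [regRelEntropy, relEntropySets, iidFamily, Family.co]

theorem hasSteinExponent_of_typeStable {R S : Family X} (hR : IsHypothesis R)
    (hS : IsHypothesis S) (hpow : ClosedUnderTensorPowers R) (hstable : TypeStable R)
    (hmix : ClosedUnderMixing S) (hsymm : PermSymmetric R ∨ ClosedUnderPerms S) :
    HasSteinExponent R S (⨅ P ∈ R.base, liminf (fun n : ℕ => ((1 / (n : ℝ) : ℝ) : EReal) *
      ⨅ Q ∈ convexHull ℝ (S n), relEntropy (tensorPow P n) Q) atTop) := by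
  have hIoo : ∀ᶠ ε : ℝ in 𝓝[>] 0, ε ∈ Set.Ioo (0 : ℝ) 1 :=
    Ioo_mem_nhdsGT one_pos
  refine tendsto_order.2 ⟨fun a ha => ?_, fun a ha => ?_⟩
  · filter_upwards [hIoo] with ε hε
    exact ha.trans_le (le_liminf_minTypeII hR hS hstable hmix hsymm hε.1 hε.2)
  · obtain ⟨c, hc, hca⟩ := EReal.lt_iff_exists_real_btwn.1 ha
    obtain ⟨c', hcc', hca⟩ := EReal.lt_iff_exists_real_btwn.1 hca
    have hη : 0 < c' - c := sub_pos.2 (EReal.coe_lt_coe_iff.1 hcc')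
    simp only [iInf_lt_iff] at hc
    obtain ⟨P, hP, hc⟩ := hc
    have hlim : Tendsto (fun ε : ℝ => c / (1 - ε) + (c' - c) / 2) (𝓝[>] 0)
        (𝓝 (c / (1 - 0) + (c' - c) / 2)) := by
      refine Tendsto.mono_left ?_ nhdsWithin_le_nhds
      exact ((tendsto_const_nhds.div (tendsto_const_nhds.sub tendsto_id) (by simp)).add_const _)
    filter_upwards [hIoo, hlim.eventually (gt_mem_nhds (show _ < c' by
      rw [sub_zero, div_one]; linarith))] with ε hε hlt
    exact ((liminf_minTypeII_le hR hS hpow hP (half_pos hη) hc hε.1 hε.2).trans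
      (EReal.coe_le_coe_iff.2 hlt.le)).trans_lt hca

end SteinExponent

end DoublyComposite

theorem theorem1 {X : Type*} [Fintype X] (R S : DoublyComposite.Family X)
    (hR : DoublyComposite.IsHypothesis R) (hS : DoublyComposite.IsHypothesis S)
    (hclosed : IsClosed R.base)
    (hpow : DoublyComposite.ClosedUnderTensorPowers R)
    (hmix : DoublyComposite.ClosedUnderMixing S)
    (hcases :
      (DoublyComposite.TypeStable R ∧
        (DoublyComposite.PermSymmetric R ∨ DoublyComposite.ClosedUnderPerms S)) ∨
      ((DoublyComposite.ClosedUnderMixing R ∧ DoublyComposite.Filtering R ∧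
          ∀ n : ℕ, 1 ≤ n → Convex ℝ (R n)) ∧
        (DoublyComposite.PermSymmetric R ∨
          (DoublyComposite.ClosedUnderPerms R ∧ DoublyComposite.ClosedUnderPerms S)))) :
    DoublyComposite.HasSteinExponent R S
        (⨅ P ∈ R.base,
          DoublyComposite.regRelEntropy (DoublyComposite.iidFamily {P}) S.co) ∧
      (⨅ P ∈ R.base, DoublyComposite.regRelEntropy (DoublyComposite.iidFamily {P}) S.co) =
        ⨅ P ∈ R.base, Filter.liminf
          (fun n : ℕ => ((1 / (n : ℝ) : ℝ) : EReal) *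
            ⨅ Q ∈ convexHull ℝ (S n),
              DoublyComposite.relEntropy (DoublyComposite.tensorPow P n) Q)
          Filter.atTop := by
  simp only [DoublyComposite.regRelEntropy_iidFamily_singleton, and_true]
  -- Filtering implies type stability, so the second set of assumptions is a case of the first.
  obtain ⟨hstable, hsymm⟩ : DoublyComposite.TypeStable R ∧
      (DoublyComposite.PermSymmetric R ∨ DoublyComposite.ClosedUnderPerms S) := by
    rcases hcases with h | ⟨⟨-, hfil, hconv⟩, hsymm⟩
    · exact h
    · refine ⟨DoublyComposite.typeStable_of_filtering hR hclosed
        (DoublyComposite.convex_base (hconv 1 le_rfl)) ?_ hfil, hsymm.imp id And.right⟩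
      exact hsymm.elim DoublyComposite.PermSymmetric.closedUnderPerms And.left
  exact DoublyComposite.hasSteinExponent_of_typeStable hR hS hpow hstable hmix hsymm
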